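/- Fix $1<p<\infty$ and let $L_p=L_p[0,1]$ be the real Lebesgue space (Borel sets, Lebesgue measure $|\cdot|$), $L_p^0=\{f\in L_p:\int f=0\}$ and $\langle f,g\rangle=\int_0^1 fg$. Let $\mathcal D^i$ be the set of the $2^i$ dyadic intervals $[\frac{j}{2^i},\frac{j+1}{2^i})\subset[0,1)$, let $h_I=\chi_{I^+}-\chi_{I^-}$ ($I^+$, $I^-$ the left and right half of the dyadic interval $I$), and let $L_p^{n,0}$ be the linear span of the $h_I$ with $I\in\mathcal D^0\cup\dots\cup\mathcal D^{n-1}$. Write $\mathrm{dist}(f)$ for the distribution of $f$. A linear operator $T$ between subspaces of $L_p$ is a distributional embedding if $\mathrm{dist}(Tf)=\mathrm{dist}(f)$ for all $f$ in its domain, and, for $0<\theta\le1$, a $\theta$-compression if $\mathrm{dist}(Tf)=\theta\,\mathrm{dist}(f)+(1-\theta)\delta_0$ for all such $f$. The support of a subspace of $L_p$ is the essentially smallest measurable set outside of which all its members vanish almost everywhere; operators have disjointly supported ranges if the supports of their ranges are pairwise essentially disjoint. For a finite-dimensional space $Y$ of bounded functions, the orthogonal projection $E:L_p\to Y$ is the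 bounded operator onto $Y$ that agrees on $L_p\cap L_2$ with the orthogonal projection of $L_2$ onto $Y$. **Proposition.** Let $n,m\in\mathbb N=\{1,2,\dots\}$, $\Gamma>0$ and $0<\epsilon<1$. There exists $k_0''=k_0''(n,m,\Gamma,\epsilon)\in\mathbb N$ (depending also on the fixed $p$) such that for every $k\ge k_0''$ and (a) every bounded linear operator $T:X\to L_p$ with $\|T\|\le\Gamma$, where $X$ is a (not necessarily closed) subspace of $L_p$, (b) all bounded linear operators $Q_1:Z\to L_p^0$ and $Q_2:X\to W$ of norm at most $\Gamma$ and rank at most $m$, where $Z$ and $W$ are real normed spaces, and (c) all $N\ge 1$ and all operators $S_1,\dots,S_N:L_p^{k,0}\to X$ with disjointly supported ranges such that, for $1\le l\le N$, $S_l$ is a $\theta_l$-compression for some $\theta_l\in(0,1]$, there exist distributional embeddings $J_l:L_p^{n,0}\to L_p^{k,0}$, $1\le l\le N$, such that $S=\sum_{l=1}^N S_lJ_l:L_p^{n,0}\to X$ is a $\theta$-compression with $\theta=\sum_{l=1}^N\theta_l$ and, denoting by $Y\subset X$ the range of $S$ (that is, the span of the functions $Sh_I$, $I\in\mathcal D^0\cup\dots\cup\mathcal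 D^{n-1}$) and by $E:L_p\to Y$ the orthogonal projection, the following hold. (i) For some $0\le i\le k-1$ and $$r=\theta^{-1}\sum_{l=1}^N\sum_{K\in\mathcal D^i}\langle S_lh_K,\,TS_lh_K\rangle,$$ we have $\big\|(ET-r\cdot\mathrm{id})|_Y\big\|<\epsilon$. (ii) $\|EQ_1\|<\epsilon$ and $\|Q_2E|_{L_p^0}\|<\epsilon$. -/

import Mathlib

open MeasureTheory
open scoped ENNReal

noncomputable section

/-- Lebesgue measure on the unit interval `[0,1]`. -/
abbrev leb01 : Measure ℝ := volume.restrict (Set.Icc (0 : ℝ) 1)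

/-- The real space `L_p = L_p[0,1]`. -/
abbrev LpI (p : ℝ≥0∞) : Type := Lp ℝ p leb01

/-- The subspace `L_p^0` of mean-zero functions. -/
def LpZero (p : ℝ≥0∞) [Fact (1 ≤ p)] : Submodule ℝ (LpI p) where
  carrier := {f | ∫ x, f x ∂leb01 = 0}
  zero_mem' := by
    have h : ∫ x, (0 : LpI p) x ∂leb01 = ∫ _, (0 : ℝ) ∂leb01 :=
      integral_congr_ae (Lp.coeFn_zero ℝ p leb01)
    simpa using h
  add_mem' := by
    intro f g hf hg
    have hi : ∀ u : LpI p, Integrable u leb01 := fun u => (Lp.memLp u).integrable Fact.out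
    have h : ∫ x, (f + g : LpI p) x ∂leb01 = ∫ x, (f x + g x) ∂leb01 :=
      integral_congr_ae (Lp.coeFn_add f g)
    have h2 := integral_add (hi f) (hi g)
    simp only [Set.mem_ofPred_eq] at hf hg ⊢
    rw [h, h2, hf, hg, add_zero]
  smul_mem' := by
    intro c f hf
    have h : ∫ x, (c • f : LpI p) x ∂leb01 = ∫ x, c * f x ∂leb01 :=
      integral_congr_ae (Lp.coeFn_smul c f)
    simp only [Set.mem_ofPred_eq] at hf ⊢
    rw [h, integral_const_mul, hf, mul_zero]

/-- The dyadic interval `[j / 2^i, (j+1) / 2^i)`; the members of `𝒟^i` are those with `j < 2^i`. -/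
def dyadic (i j : ℕ) : Set ℝ := Set.Ico ((j : ℝ) / 2 ^ i) (((j : ℝ) + 1) / 2 ^ i)

/-- The characteristic function of a dyadic interval, as an element of `L_p`. -/
def dyadicChi (p : ℝ≥0∞) (i j : ℕ) : LpI p :=
  indicatorConstLp p (s := dyadic i j) (μ := leb01) measurableSet_Ico (measure_ne_top _ _) (1 : ℝ)

/-- The Haar function `h_I = χ_{I⁺} - χ_{I⁻}` of `I = [j / 2^i, (j+1) / 2^i)`, where `I⁺` and `I⁻`
are the left and the right half of `I`. -/
def haar (p : ℝ≥0∞) (i j : ℕ) : LpI p :=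
  dyadicChi p (i + 1) (2 * j) - dyadicChi p (i + 1) (2 * j + 1)

/-- `L_p^{n,0}`, the linear span of the Haar functions `h_I`, `I ∈ 𝒟_{n-1} = 𝒟^0 ∪ ⋯ ∪ 𝒟^{n-1}`. -/
def LpHaar (p : ℝ≥0∞) (n : ℕ) : Submodule ℝ (LpI p) :=
  Submodule.span ℝ {h | ∃ i j : ℕ, i < n ∧ j < 2 ^ i ∧ h = haar p i j}

/-- The Haar function `h_K`, `K ∈ 𝒟^i`, `i < n`, as an element of `L_p^{n,0}`. -/
def haarIn (p : ℝ≥0∞) (n : ℕ) (i : Fin n) (j : Fin (2 ^ (i : ℕ))) : LpHaar p n :=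
  ⟨haar p i j, Submodule.subset_span ⟨i, j, i.2, j.2, rfl⟩⟩

/-- The distribution of a function on `[0,1]`. -/
def distr {p : ℝ≥0∞} (f : LpI p) : Measure ℝ := leb01.map f

/-- The pairing `⟨f, g⟩ = ∫ f g`. -/
def pairing {p : ℝ≥0∞} (f g : LpI p) : ℝ := ∫ x, f x * g x ∂leb01

/-- Distributional embeddings: linear operators with `dist (T f) = dist f`. -/
def IsDistEmbedding {p : ℝ≥0∞} {X Y : Submodule ℝ (LpI p)} (T : X →ₗ[ℝ] Y) : Prop :=
  ∀ f : X, distr (T f : LpI p) = distr (f : LpI p)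

/-- `θ`-compressions, `0 < θ ≤ 1`: linear operators with
`dist (T f) = θ dist f + (1 - θ) δ_0`. -/
def IsCompression {p : ℝ≥0∞} {X Y : Submodule ℝ (LpI p)} (θ : ℝ) (T : X →ₗ[ℝ] Y) : Prop :=
  0 < θ ∧ θ ≤ 1 ∧ ∀ f : X, distr (T f : LpI p) =
    ENNReal.ofReal θ • distr (f : LpI p) + ENNReal.ofReal (1 - θ) • Measure.dirac 0

/-- The range of an operator `S : V → X`, as a subspace of `L_p`. -/
def rangeLp {p : ℝ≥0∞} {V X : Submodule ℝ (LpI p)} (S : V →ₗ[ℝ] X) : Submodule ℝ (LpI p) :=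
  LinearMap.range (X.subtype ∘ₗ S)

theorem rangeLp_le {p : ℝ≥0∞} {V X : Submodule ℝ (LpI p)} (S : V →ₗ[ℝ] X) : rangeLp S ≤ X := by
  rintro _ ⟨v, rfl⟩
  exact (S v).2

/-- The inclusion of the range of `S : V → X` into `X`. -/
def rangeIncl {p : ℝ≥0∞} [Fact (1 ≤ p)] {V X : Submodule ℝ (LpI p)} (S : V →ₗ[ℝ] X) :
    rangeLp S →L[ℝ] X :=
  (rangeLp S).subtypeL.codRestrict X (fun y => rangeLp_le S y.2)

/-- `supp X ⊂ A`, in the essential sense. -/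
def SuppIn {p : ℝ≥0∞} (X : Submodule ℝ (LpI p)) (A : Set ℝ) : Prop :=
  ∀ f ∈ X, ∀ᵐ x ∂leb01, f x ≠ 0 → x ∈ A

/-- `supp X = A`: the set `A` is the essentially smallest measurable set with `supp X ⊂ A`. -/
def IsSupp {p : ℝ≥0∞} (X : Submodule ℝ (LpI p)) (A : Set ℝ) : Prop :=
  MeasurableSet A ∧ SuppIn X A ∧
    ∀ B : Set ℝ, MeasurableSet B → SuppIn X B → ∀ᵐ x ∂leb01, x ∈ A → x ∈ B

/-- The operators `S_l` have disjointly supported ranges: the supports of their ranges are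
pairwise essentially disjoint. -/
def DisjointRanges {p : ℝ≥0∞} {V X : Submodule ℝ (LpI p)} {N : ℕ}
    (S : Fin N → (V →ₗ[ℝ] X)) : Prop :=
  ∃ A : Fin N → Set ℝ, (∀ l, IsSupp (rangeLp (S l)) (A l)) ∧
    ∀ l l', l ≠ l' → leb01 (A l ∩ A l') = 0

/-- `E : L_p → Y` is the orthogonal projection onto `Y`: it is onto `Y` and, on `L_p ∩ L_2`, it is
given by a self-adjoint idempotent operator `P` of `L_2`. -/
def IsOrthProj {p : ℝ≥0∞} [Fact (1 ≤ p)] (Y : Submodule ℝ (LpI p)) (E : LpI p →L[ℝ] Y) : Prop :=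
  Function.Surjective E ∧ ∃ P : LpI 2 →L[ℝ] LpI 2, IsStarProjection P ∧
    ∀ (f : LpI p) (g : LpI 2), (f : ℝ → ℝ) =ᵐ[leb01] g →
      ((E f : LpI p) : ℝ → ℝ) =ᵐ[leb01] (P g : LpI 2)

/-- The operator `S = ∑_l S_l J_l`. -/
def assembled {p : ℝ≥0∞} {U V X : Submodule ℝ (LpI p)} {N : ℕ}
    (S : Fin N → (V →ₗ[ℝ] X)) (J : Fin N → (U →ₗ[ℝ] V)) : U →ₗ[ℝ] X :=
  ∑ l, S l ∘ₗ J l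

/-- The average `r = θ⁻¹ ∑_l ∑_{K ∈ 𝒟^i} ⟨S_l h_K, T S_l h_K⟩`. -/
def diagAverage {p : ℝ≥0∞} [Fact (1 ≤ p)] {k N : ℕ} {X : Submodule ℝ (LpI p)} (T : X →L[ℝ] LpI p)
    (S : Fin N → (LpHaar p k →ₗ[ℝ] X)) (θ : ℝ) (i : Fin k) : ℝ :=
  θ⁻¹ * ∑ l, ∑ j : Fin (2 ^ (i : ℕ)),
    pairing (S l (haarIn p k i j) : LpI p) (T (S l (haarIn p k i j)))

end

/-!
Each `J_l` sends a Haar function `h_I` of level `t` to a signed sum of Haar functions of a level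
`g t`, taken over the block of nodes on which the signs chosen at the levels `g s`, `s < t`, have
the pattern prescribed by `I`. Whatever the signs on the nodes of the trees `1, …, N` and the levels
`g 0 < … < g (n - 1)`, the resulting operators are distributional embeddings.

By Hölder's inequality a functional `f ↦ ⟨f, ∑_l S_l f_l⟩` is at most a constant times
`|supp u|^κ` on functions `u = ∑_l S_l f_l` with values in `[-1, 1]`, where `κ = min(1/p, 1 - 1/p)`.
Hence its values at the Haar functions of level `i` have a square sum of order `2^{-iκ}`, uniformly
in `N` after division by a power of `θ`; the same holds for the bilinear form `⟨T S f, S g⟩`. On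
high levels random signs therefore make, by a second moment estimate, the given functionals and all
the off-diagonal entries `⟨T S h_I, S h_J⟩` small; they also make each diagonal entry nearly equal
to the trace of the form over the corresponding block, and split the traces over blocks of higher
levels nearly in half. Since the normalized traces of the levels are bounded, the levels `g t` can
be chosen by the pigeonhole principle with nearly the same trace `r`, and then
`⟨T S h_I, S h_I⟩ ≈ r ‖S h_I‖_2^2`. As `E` is given by an explicit formula in the orthogonal
system `S h_I`, these estimates of finitely many entries bound the operator norms, with constants
that depend only on `n` and `m`.
-/

open scoped BigOperators

section Signs

/-- The inclusion of the signs `±1` into the real numbers. -/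
def realSign : ℤˣ →* ℝ := (Int.castRingHom ℝ : ℤ →* ℝ).comp (Units.coeHom ℤ)

theorem realSign_apply (e : ℤˣ) : realSign e = ((e : ℤ) : ℝ) := rfl

@[simp] theorem realSign_neg (e : ℤˣ) : realSign (-e) = -realSign e := by simp [realSign_apply]

theorem realSign_mul_self (e : ℤˣ) : realSign e * realSign e = 1 := by
  rw [← map_mul, Int.units_mul_self, map_one]

@[simp] theorem abs_realSign (e : ℤˣ) : |realSign e| = 1 := by
  rcases Int.units_eq_one_or e with rfl | rfl <;> simp

theorem exists_realSign_mul_eq_abs (x : ℝ) : ∃ e : ℤˣ, realSign e * x = |x| := by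
  rcases le_total 0 x with hx | hx
  · exact ⟨1, by simp [abs_of_nonneg hx]⟩
  · exact ⟨-1, by simp [abs_of_nonpos hx]⟩

section Moments

variable {α : Type*} [Fintype α]

theorem sum_sign_form_sub_trace (σ : α → ℤˣ) (c : α → α → ℝ) :
    ∑ a, ∑ b, realSign (σ a) * realSign (σ b) * c a b - ∑ a, c a a =
      ∑ q ∈ Finset.univ.offDiag, realSign (σ q.1) * realSign (σ q.2) * c q.1 q.2 := by
  classical
  rw [← Fintype.sum_prod_type' fun a b => realSign (σ a) * realSign (σ b) * c a b,
    ← Finset.univ_product_univ, ← Finset.diag_union_offDiag,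
    Finset.sum_union (Finset.disjoint_diag_offDiag _), Finset.sum_diag]
  simp [realSign_mul_self]

variable [DecidableEq α]

theorem expect_eq_zero_of_flip (f : (α → ℤˣ) → ℝ) (a : α)
    (hf : ∀ σ, f (Function.update σ a (-σ a)) = -f σ) : 𝔼 σ, f σ = 0 := by
  have hinv : Function.Involutive fun σ : α → ℤˣ => Function.update σ a (-σ a) := fun σ => by
    simp
  have h : 𝔼 σ, -f σ = 𝔼 σ, f σ :=
    Fintype.expect_equiv hinv.toPerm _ _ fun σ => (hf σ).symm
  rw [Finset.expect_neg_distrib] at h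
  linarith

theorem expect_sign_mul (a b : α) :
    𝔼 σ : α → ℤˣ, realSign (σ a) * realSign (σ b) = if a = b then 1 else 0 := by
  split_ifs with hab
  · simp [hab, realSign_mul_self]
  · exact expect_eq_zero_of_flip _ a fun σ => by simp [Function.update_of_ne (Ne.symm hab)]

theorem expect_sign_mul_sign_mul {a b c d : α} (hab : a ≠ b) :
    𝔼 σ : α → ℤˣ, realSign (σ a) * realSign (σ b) * (realSign (σ c) * realSign (σ d)) =
      (if (c, d) = (a, b) then 1 else 0) + (if (c, d) = (b, a) then 1 else 0) := by
  by_cases hca : c = a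
  · subst hca
    have h : ∀ σ : α → ℤˣ, realSign (σ c) * realSign (σ b) * (realSign (σ c) * realSign (σ d)) =
        realSign (σ b) * realSign (σ d) := fun σ => by
      linear_combination realSign (σ b) * realSign (σ d) * realSign_mul_self (σ c)
    simp [h, expect_sign_mul, Ne.symm hab, eq_comm]
  by_cases hda : d = a
  · subst hda
    have h : ∀ σ : α → ℤˣ, realSign (σ d) * realSign (σ b) * (realSign (σ c) * realSign (σ d)) =
        realSign (σ b) * realSign (σ c) := fun σ => by
      linear_combination realSign (σ b) * realSign (σ c) * realSign_mul_self (σ d)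
    simp [h, expect_sign_mul, hca, eq_comm]
  · rw [expect_eq_zero_of_flip _ a fun σ => by
      simp [Function.update_of_ne (Ne.symm hab), Function.update_of_ne hca,
        Function.update_of_ne hda]]
    simp [hca, hda]

theorem expect_sq_sum_sign_mul (x : α → ℝ) :
    𝔼 σ : α → ℤˣ, (∑ a, realSign (σ a) * x a) ^ 2 = ∑ a, x a ^ 2 := by
  have hprod : ∀ (σ : α → ℤˣ) (a b : α), realSign (σ a) * x a * (realSign (σ b) * x b) =
      realSign (σ a) * realSign (σ b) * (x a * x b) := fun σ a b => by ring
  simp_rw [sq, Finset.sum_mul_sum, Finset.expect_sum_comm, hprod, ← Finset.expect_mul,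
    expect_sign_mul]
  simp

theorem expect_sq_sum_sign_form_sub_trace_le (c : α → α → ℝ) :
    𝔼 σ : α → ℤˣ, (∑ a, ∑ b, realSign (σ a) * realSign (σ b) * c a b - ∑ a, c a a) ^ 2 ≤
      2 * ∑ a, ∑ b, c a b ^ 2 := by
  set D : Finset (α × α) := Finset.univ.offDiag
  have hprod : ∀ (σ : α → ℤˣ) (q q' : α × α),
      realSign (σ q.1) * realSign (σ q.2) * c q.1 q.2 *
        (realSign (σ q'.1) * realSign (σ q'.2) * c q'.1 q'.2) =
      realSign (σ q.1) * realSign (σ q.2) * (realSign (σ q'.1) * realSign (σ q'.2)) *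
        (c q.1 q.2 * c q'.1 q'.2) := fun σ q q' => by ring
  have hswap : ∑ q ∈ D, c q.2 q.1 ^ 2 = ∑ q ∈ D, c q.1 q.2 ^ 2 :=
    Finset.sum_nbij' Prod.swap Prod.swap (by simp [D, eq_comm]) (by simp [D, eq_comm])
      (by simp) (by simp) (by simp)
  calc 𝔼 σ : α → ℤˣ, (∑ a, ∑ b, realSign (σ a) * realSign (σ b) * c a b - ∑ a, c a a) ^ 2
      = ∑ q ∈ D, ∑ q' ∈ D, ((if q' = q then 1 else 0) + if q' = q.swap then 1 else 0) *
          (c q.1 q.2 * c q'.1 q'.2) := by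
        simp_rw [sum_sign_form_sub_trace, sq, Finset.sum_mul_sum, Finset.expect_sum_comm, hprod,
          ← Finset.expect_mul]
        refine Finset.sum_congr rfl fun q hq => Finset.sum_congr rfl fun q' _ => ?_
        rw [expect_sign_mul_sign_mul (Finset.mem_offDiag.mp hq).2.2]
        rfl
    _ = ∑ q ∈ D, (c q.1 q.2 * c q.1 q.2 + c q.1 q.2 * c q.2 q.1) := by
        refine Finset.sum_congr rfl fun q hq => ?_
        have hq' : q.swap ∈ D := by simpa [D, eq_comm] using hq
        simp [add_mul, Finset.sum_add_distrib, hq, hq']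
    _ ≤ ∑ q ∈ D, (c q.1 q.2 ^ 2 + (c q.1 q.2 ^ 2 + c q.2 q.1 ^ 2) / 2) :=
        Finset.sum_le_sum fun q _ => by nlinarith [sq_nonneg (c q.1 q.2 - c q.2 q.1)]
    _ = 2 * ∑ q ∈ D, c q.1 q.2 ^ 2 := by
        rw [Finset.sum_add_distrib, ← Finset.sum_div, Finset.sum_add_distrib, hswap]; ring
    _ ≤ 2 * ∑ a, ∑ b, c a b ^ 2 := by
        rw [← Fintype.sum_prod_type' fun a b => c a b ^ 2]
        gcongr
        exact Finset.subset_univ D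

end Moments

variable {α : Type*}

/-- Averaging the sum of the squares of all the deviations over the signs. -/
theorem exists_signs_of_fintype [Fintype α] {ι ι' : Type*} [Fintype ι] [Fintype ι']
    (x : ι → α → ℝ) (c : ι' → α → α → ℝ) {η : ℝ} (hx : ∀ i, ∑ a, x i a ^ 2 ≤ η)
    (hc : ∀ i, ∑ a, ∑ b, c i a b ^ 2 ≤ η) :
    ∃ σ : α → ℤˣ,
      (∀ i, (∑ a, realSign (σ a) * x i a) ^ 2 ≤
        (Fintype.card ι + 2 * Fintype.card ι') * η) ∧
      ∀ i, (∑ a, ∑ b, realSign (σ a) * realSign (σ b) * c i a b - ∑ a, c i a a) ^ 2 ≤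
        (Fintype.card ι + 2 * Fintype.card ι') * η := by
  classical
  let F : ι → (α → ℤˣ) → ℝ := fun i σ => (∑ a, realSign (σ a) * x i a) ^ 2
  let G : ι' → (α → ℤˣ) → ℝ := fun i σ =>
    (∑ a, ∑ b, realSign (σ a) * realSign (σ b) * c i a b - ∑ a, c i a a) ^ 2
  have hF : ∀ i σ, 0 ≤ F i σ := fun i σ => sq_nonneg _
  have hG : ∀ i σ, 0 ≤ G i σ := fun i σ => sq_nonneg _
  have hmean : 𝔼 σ, (∑ i, F i σ + ∑ i, G i σ) ≤ (Fintype.card ι + 2 * Fintype.card ι') * η := by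
    rw [Finset.expect_add_distrib, Finset.expect_sum_comm, Finset.expect_sum_comm, add_mul]
    refine add_le_add ?_ ?_
    · calc ∑ i, 𝔼 σ, F i σ ≤ ∑ _i : ι, η := Finset.sum_le_sum fun i _ =>
            (expect_sq_sum_sign_mul (x i)).trans_le (hx i)
        _ = Fintype.card ι * η := by simp
    · calc ∑ i, 𝔼 σ, G i σ ≤ ∑ _i : ι', 2 * η := Finset.sum_le_sum fun i _ =>
            (expect_sq_sum_sign_form_sub_trace_le (c i)).trans (by linarith [hc i])
        _ = 2 * Fintype.card ι' * η := by simp; ring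
  obtain ⟨σ, -, hσ⟩ := Finset.exists_le_of_expect_le Finset.univ_nonempty hmean
  refine ⟨σ, fun i => ?_, fun i => ?_⟩
  · calc F i σ ≤ ∑ i, F i σ := Finset.single_le_sum (fun i _ => hF i σ) (Finset.mem_univ i)
      _ ≤ ∑ i, F i σ + ∑ i, G i σ := le_add_of_nonneg_right (Finset.sum_nonneg fun i _ => hG i σ)
      _ ≤ _ := hσ
  · calc G i σ ≤ ∑ i, G i σ := Finset.single_le_sum (fun i _ => hG i σ) (Finset.mem_univ i)
      _ ≤ ∑ i, F i σ + ∑ i, G i σ := le_add_of_nonneg_left (Finset.sum_nonneg fun i _ => hF i σ)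
      _ ≤ _ := hσ

theorem exists_signs_sum_diag_le_of_fintype [Fintype α] (c : α → α → ℝ) :
    ∃ σ : α → ℤˣ, ∑ a, c a a ≤ ∑ a, ∑ b, realSign (σ a) * realSign (σ b) * c a b := by
  classical
  obtain ⟨σ, -, hσ⟩ := Finset.exists_le_of_le_expect (s := Finset.univ)
    (f := fun σ : α → ℤˣ => ∑ a, ∑ b, realSign (σ a) * realSign (σ b) * c a b)
    (a := ∑ a, c a a) Finset.univ_nonempty (by
      simp_rw [Finset.expect_sum_comm, ← Finset.expect_mul, expect_sign_mul]
      simp)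
  exact ⟨σ, hσ⟩

theorem exists_signs {ι ι' : Type*} [Fintype ι] [Fintype ι'] (A : Finset α) (x : ι → α → ℝ)
    (c : ι' → α → α → ℝ) {η : ℝ} (hx : ∀ i, ∑ a ∈ A, x i a ^ 2 ≤ η)
    (hc : ∀ i, ∑ a ∈ A, ∑ b ∈ A, c i a b ^ 2 ≤ η) :
    ∃ σ : α → ℤˣ,
      (∀ i, (∑ a ∈ A, realSign (σ a) * x i a) ^ 2 ≤
        (Fintype.card ι + 2 * Fintype.card ι') * η) ∧
      ∀ i, (∑ a ∈ A, ∑ b ∈ A, realSign (σ a) * realSign (σ b) * c i a b -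
        ∑ a ∈ A, c i a a) ^ 2 ≤ (Fintype.card ι + 2 * Fintype.card ι') * η := by
  classical
  simp_rw [← Finset.sum_coe_sort A] at hx hc ⊢
  obtain ⟨σ, hσx, hσc⟩ :=
    exists_signs_of_fintype (fun i (a : A) => x i a) (fun i (a b : A) => c i a b) hx hc
  exact ⟨fun a => if h : a ∈ A then σ ⟨a, h⟩ else 1, by simpa using hσx, by simpa using hσc⟩

theorem exists_signs_of_label {ι : Type*} [Fintype ι] (A : Finset α) (lb : α → ℕ) (J : ℕ)
    (x : ι → α → ℝ) (c : α → α → ℝ) {η δ : ℝ} (hδ : 0 ≤ δ) (hx : ∀ i, ∑ a ∈ A, x i a ^ 2 ≤ η)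
    (hc : ∑ a ∈ A, ∑ b ∈ A, c a b ^ 2 ≤ η)
    (hη : (J * Fintype.card ι + 2 * (J * J)) * η ≤ δ ^ 2) :
    ∃ σ : α → ℤˣ,
      (∀ j < J, ∀ i, |∑ a ∈ A with lb a = j, realSign (σ a) * x i a| ≤ δ) ∧
      ∀ j < J, ∀ j' < J,
        |∑ a ∈ A with lb a = j, ∑ b ∈ A with lb b = j', realSign (σ a) * realSign (σ b) * c a b -
          ∑ a ∈ A with lb a = j ∧ lb a = j', c a a| ≤ δ := by
  obtain ⟨σ, hσx, hσc⟩ := exists_signs (ι := Fin J × ι) (ι' := Fin J × Fin J) (η := η) A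
    (fun r a => if lb a = r.1 then x r.2 a else 0)
    (fun r a b => if lb a = r.1 ∧ lb b = r.2 then c a b else 0)
    (fun r => (Finset.sum_le_sum fun a _ => by split_ifs <;> simp [sq_nonneg]).trans (hx r.2))
    (fun r => (Finset.sum_le_sum fun a _ => Finset.sum_le_sum fun b _ => by
      split_ifs <;> simp [sq_nonneg]).trans hc)
  simp only [Fintype.card_prod, Fintype.card_fin, Nat.cast_mul] at hσx hσc
  refine ⟨σ, fun j hj i => ?_, fun j hj j' hj' => ?_⟩
  · have h := abs_le_of_sq_le_sq ((hσx (⟨j, hj⟩, i)).trans hη) hδ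
    simpa only [mul_ite, mul_zero, Finset.sum_filter] using h
  · have h := abs_le_of_sq_le_sq ((hσc (⟨j, hj⟩, ⟨j', hj'⟩)).trans hη) hδ
    simpa only [mul_ite, mul_zero, ite_and, Finset.sum_filter, Finset.sum_ite_irrel,
      Finset.sum_const_zero] using h

theorem exists_signs_sum_diag_le (A : Finset α) (c : α → α → ℝ) :
    ∃ σ : α → ℤˣ,
      ∑ a ∈ A, c a a ≤ ∑ a ∈ A, ∑ b ∈ A, realSign (σ a) * realSign (σ b) * c a b := by
  classical
  simp_rw [← Finset.sum_coe_sort A]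
  obtain ⟨σ, hσ⟩ := exists_signs_sum_diag_le_of_fintype fun a b : A => c a b
  exact ⟨fun a => if h : a ∈ A then σ ⟨a, h⟩ else 1, by simpa using hσ⟩

end Signs

section Tree

variable {ι : Type*}

/-- The nodes of level `i` of a forest of dyadic trees with one tree for every element of `ι`; the
node `(l, j)` stands for the interval `[j / 2^i, (j+1) / 2^i)` of the tree `l`. -/
def treeLevel (ι : Type*) [Fintype ι] (i : ℕ) : Finset (ι × ℕ) :=
  Finset.univ ×ˢ Finset.range (2 ^ i)

/-- The ancestor of a node, `d` levels up. -/
def ancestor (d : ℕ) (a : ι × ℕ) : ι × ℕ := (a.1, a.2 / 2 ^ d)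

/-- The sign on a node of the Haar function of its ancestor `d + 1` levels up. -/
def halfSign (d : ℕ) (a : ι × ℕ) : ℤˣ := (-1) ^ (a.2 / 2 ^ d)

theorem mem_treeLevel [Fintype ι] {i : ℕ} {a : ι × ℕ} : a ∈ treeLevel ι i ↔ a.2 < 2 ^ i := by
  simp [treeLevel]

theorem ancestor_mem_treeLevel [Fintype ι] {i i' : ℕ} (h : i ≤ i') {a : ι × ℕ}
    (ha : a ∈ treeLevel ι i') : ancestor (i' - i) a ∈ treeLevel ι i := by
  rw [mem_treeLevel] at ha ⊢
  rwa [ancestor, Nat.div_lt_iff_lt_mul (by positivity), ← pow_add, Nat.add_sub_of_le h]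

@[simp] theorem ancestor_zero (a : ι × ℕ) : ancestor 0 a = a := by simp [ancestor]

theorem ancestor_ancestor (d d' : ℕ) (a : ι × ℕ) :
    ancestor d (ancestor d' a) = ancestor (d' + d) a := by
  simp [ancestor, Nat.div_div_eq_div_mul, pow_add]

theorem halfSign_ancestor (d d' : ℕ) (a : ι × ℕ) :
    halfSign d (ancestor d' a) = halfSign (d' + d) a := by
  simp [ancestor, halfSign, Nat.div_div_eq_div_mul, pow_add]

/-- The label of a node of level `g s`: the binary word of length `s` given by the signs on this
node of the signed Haar functions of the levels `g 0, …, g (s - 1)`. -/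
def label (g : ℕ → ℕ) (σ : ℕ → ι × ℕ → ℤˣ) : ℕ → ι × ℕ → ℕ
  | 0 => fun _ => 0
  | s + 1 => fun a => 2 * label g σ s (ancestor (g (s + 1) - g s) a) +
      if halfSign (g (s + 1) - g s - 1) a * σ s (ancestor (g (s + 1) - g s) a) = 1 then 0 else 1

theorem label_congr (g : ℕ → ℕ) {σ τ : ℕ → ι × ℕ → ℤˣ} {s : ℕ} (h : ∀ t < s, σ t = τ t) :
    label g σ s = label g τ s := by
  induction s with
  | zero => rfl
  | succ s ih =>
    funext a
    rw [label, label, ih fun t ht => h t (by omega), h s (by omega)]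

theorem label_lt (g : ℕ → ℕ) (σ : ℕ → ι × ℕ → ℤˣ) (s : ℕ) (a : ι × ℕ) : label g σ s a < 2 ^ s := by
  induction s generalizing a with
  | zero => simp [label]
  | succ s ih =>
    have := ih (ancestor (g (s + 1) - g s) a)
    simp only [label, pow_succ]
    split_ifs <;> omega

theorem label_succ_ancestor {g : ℕ → ℕ} (hg : StrictMono g) (σ : ℕ → ι × ℕ → ℤˣ) {s t : ℕ}
    (hst : s < t) (a : ι × ℕ) :
    label g σ (s + 1) (ancestor (g t - g (s + 1)) a) =
      2 * label g σ s (ancestor (g t - g s) a) +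
        if halfSign (g t - g s - 1) a * σ s (ancestor (g t - g s) a) = 1 then 0 else 1 := by
  have h : g s < g (s + 1) := hg s.lt_succ_self
  have h' : g (s + 1) ≤ g t := hg.monotone hst
  simp only [label, ancestor_ancestor, halfSign_ancestor]
  rw [show g t - g (s + 1) + (g (s + 1) - g s) = g t - g s by omega,
    show g t - g (s + 1) + (g (s + 1) - g s - 1) = g t - g s - 1 by omega]

/-- The total weight of a set of nodes of level `i`, when the weight `w l` of the tree `l` is
distributed equally over its nodes of this level. -/
noncomputable def nodeWeight (w : ι → ℝ) (i : ℕ) (B : Finset (ι × ℕ)) : ℝ := ∑ a ∈ B, w a.1 / 2 ^ i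

theorem nodeWeight_singleton (w : ι → ℝ) (i : ℕ) (a : ι × ℕ) :
    nodeWeight w i {a} = w a.1 / 2 ^ i := Finset.sum_singleton _ _

variable [Fintype ι]

/-- The set of nodes of level `g s` with label `j`. -/
def block (g : ℕ → ℕ) (σ : ℕ → ι × ℕ → ℤˣ) (s j : ℕ) : Finset (ι × ℕ) :=
  {a ∈ treeLevel ι (g s) | label g σ s a = j}

theorem block_subset (g : ℕ → ℕ) (σ : ℕ → ι × ℕ → ℤˣ) (s j : ℕ) :
    block g σ s j ⊆ treeLevel ι (g s) := Finset.filter_subset _ _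

theorem block_congr (g : ℕ → ℕ) {σ τ : ℕ → ι × ℕ → ℤˣ} {s : ℕ} (h : ∀ t < s, σ t = τ t) (j : ℕ) :
    block g σ s j = block g τ s j := by
  rw [block, block, label_congr g h]

end Tree

section Weights

variable {ι : Type*} {w : ι → ℝ}

theorem nodeWeight_nonneg (hw : ∀ l, 0 ≤ w l) (i : ℕ) (B : Finset (ι × ℕ)) :
    0 ≤ nodeWeight w i B :=
  Finset.sum_nonneg fun a _ => div_nonneg (hw a.1) (by positivity)

theorem nodeWeight_const_mul (c : ℝ) (w : ι → ℝ) (i : ℕ) (B : Finset (ι × ℕ)) :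
    nodeWeight (fun l => c * w l) i B = c * nodeWeight w i B := by
  simp only [nodeWeight, Finset.mul_sum, mul_div_assoc]

variable [Fintype ι]

theorem nodeWeight_treeLevel (w : ι → ℝ) (i : ℕ) : nodeWeight w i (treeLevel ι i) = ∑ l, w l := by
  rw [nodeWeight, treeLevel, Finset.sum_product]
  refine Finset.sum_congr rfl fun l _ => ?_
  simp only [Finset.sum_const, Finset.card_range, nsmul_eq_mul]
  push_cast
  field_simp

theorem nodeWeight_le_one (hw : w ∈ stdSimplex ℝ ι) {i : ℕ} {B : Finset (ι × ℕ)}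
    (hB : B ⊆ treeLevel ι i) : nodeWeight w i B ≤ 1 := by
  rw [← hw.2, ← nodeWeight_treeLevel w i]
  exact Finset.sum_le_sum_of_subset_of_nonneg hB fun a _ _ => div_nonneg (hw.1 a.1) (by positivity)

theorem nodeWeight_singleton_le (hw : w ∈ stdSimplex ℝ ι) (i : ℕ) (a : ι × ℕ) :
    nodeWeight w i {a} ≤ (1 / 2) ^ i := by
  have hwa : w a.1 ≤ 1 := by
    rw [← hw.2]
    exact Finset.single_le_sum (fun l _ => hw.1 l) (Finset.mem_univ a.1)
  rw [nodeWeight_singleton, one_div, inv_pow, ← one_div]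
  gcongr

theorem filter_ancestor_eq [DecidableEq ι] {i d : ℕ} {b : ι × ℕ} (hb : b ∈ treeLevel ι i) :
    {a ∈ treeLevel ι (i + d) | ancestor d a = b} =
      (Finset.range (2 ^ d)).image fun r => (b.1, b.2 * 2 ^ d + r) := by
  ext ⟨l, K⟩
  obtain ⟨l', K'⟩ := b
  rw [mem_treeLevel] at hb
  simp only [Finset.mem_filter, mem_treeLevel, ancestor, Prod.mk.injEq, Finset.mem_image,
    Finset.mem_range] at hb ⊢
  constructor
  · rintro ⟨-, rfl, rfl⟩
    exact ⟨K % 2 ^ d, Nat.mod_lt _ (by positivity), rfl, Nat.div_add_mod' K (2 ^ d)⟩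
  · rintro ⟨r, hr, rfl, rfl⟩
    refine ⟨?_, rfl, ?_⟩
    · rw [pow_add]
      nlinarith [Nat.mul_le_mul_right (2 ^ d) (Nat.succ_le_of_lt hb)]
    · rw [mul_comm, Nat.mul_add_div (by positivity), Nat.div_eq_of_lt hr, add_zero]

theorem nodeWeight_filter_ancestor [DecidableEq ι] (w : ι → ℝ) {i i' : ℕ} (h : i ≤ i') {b : ι × ℕ}
    (hb : b ∈ treeLevel ι i) :
    nodeWeight w i' {a ∈ treeLevel ι i' | ancestor (i' - i) a = b} = w b.1 / 2 ^ i := by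
  obtain ⟨d, rfl⟩ := Nat.exists_eq_add_of_le h
  rw [Nat.add_sub_cancel_left, filter_ancestor_eq hb, nodeWeight,
    Finset.sum_image fun r _ r' _ hrr => by simpa using hrr, pow_add]
  simp only [Finset.sum_const, Finset.card_range, nsmul_eq_mul]
  push_cast
  field_simp

theorem sum_sq_le_of_sum_abs_le (hw : w ∈ stdSimplex ℝ ι) {i : ℕ} {x : ι × ℕ → ℝ} {C κ : ℝ}
    (hC : 0 ≤ C) (hκ : 0 ≤ κ)
    (hx : ∀ B ⊆ treeLevel ι i, ∑ a ∈ B, |x a| ≤ C * nodeWeight w i B ^ κ) :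
    ∑ a ∈ treeLevel ι i, x a ^ 2 ≤ C ^ 2 * ((1 / 2 : ℝ) ^ i) ^ κ := by
  have hsup : ∀ a ∈ treeLevel ι i, |x a| ≤ C * ((1 / 2 : ℝ) ^ i) ^ κ := fun a ha => by
    have h := hx {a} (Finset.singleton_subset_iff.mpr ha)
    rw [Finset.sum_singleton] at h
    have := Real.rpow_le_rpow (nodeWeight_nonneg hw.1 _ _) (nodeWeight_singleton_le hw i a) hκ
    exact h.trans (by gcongr)
  have hsum : ∑ a ∈ treeLevel ι i, |x a| ≤ C := by
    simpa [nodeWeight_treeLevel, hw.2] using hx _ subset_rfl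
  calc ∑ a ∈ treeLevel ι i, x a ^ 2
      ≤ ∑ a ∈ treeLevel ι i, C * ((1 / 2 : ℝ) ^ i) ^ κ * |x a| :=
        Finset.sum_le_sum fun a ha => by
          rw [← sq_abs, sq]
          exact mul_le_mul_of_nonneg_right (hsup a ha) (abs_nonneg _)
    _ = C * ((1 / 2 : ℝ) ^ i) ^ κ * ∑ a ∈ treeLevel ι i, |x a| := by rw [Finset.mul_sum]
    _ ≤ C * ((1 / 2 : ℝ) ^ i) ^ κ * C := by gcongr
    _ = _ := by ring

end Weights

section FormBounds

variable {ι V : Type*} [Fintype ι] [AddCommGroup V] [Module ℝ V] {k : ℕ} {w : ι → ℝ}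
  {e : ℕ → ι × ℕ → V}

/-- Linear functionals with `|Λ u| ≤ C |supp u|^κ` on combinations `u` with coefficients in
`[-1, 1]` of the vectors attached to the nodes of one level. -/
def FunctionalBound (k : ℕ) (w : ι → ℝ) (e : ℕ → ι × ℕ → V) (Λ : V →ₗ[ℝ] ℝ) (C κ : ℝ) : Prop :=
  ∀ i < k, ∀ B ⊆ treeLevel ι i, ∀ ξ : ι × ℕ → ℝ, (∀ a, |ξ a| ≤ 1) →
    |Λ (∑ a ∈ B, ξ a • e i a)| ≤ C * nodeWeight w i B ^ κ

/-- Bilinear forms with `|β(u, v)| ≤ C |supp u|^x |supp v|^y` on combinations `u`, `v` with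
coefficients in `[-1, 1]` of the vectors attached to the nodes of one level each. -/
def FormBound (k : ℕ) (w : ι → ℝ) (e : ℕ → ι × ℕ → V) (β : V →ₗ[ℝ] V →ₗ[ℝ] ℝ)
    (C x y : ℝ) : Prop :=
  ∀ i < k, ∀ B ⊆ treeLevel ι i, ∀ ξ : ι × ℕ → ℝ, (∀ a, |ξ a| ≤ 1) →
    FunctionalBound k w e (β (∑ a ∈ B, ξ a • e i a)) (C * nodeWeight w i B ^ x) y

theorem rpow_half_pow_le {i : ℕ} {κ y : ℝ} (h : κ ≤ y) :
    ((1 / 2 : ℝ) ^ i) ^ y ≤ ((1 / 2 : ℝ) ^ i) ^ κ :=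
  Real.rpow_le_rpow_of_exponent_ge (by positivity) (pow_le_one₀ (by norm_num) (by norm_num)) h

namespace FunctionalBound

variable {Λ : V →ₗ[ℝ] ℝ} {C κ : ℝ}

theorem mono (hw : w ∈ stdSimplex ℝ ι) (h : FunctionalBound k w e Λ C κ) {C' κ' : ℝ}
    (hCC' : C ≤ C') (hC' : 0 ≤ C') (hκ' : 0 ≤ κ') (hκκ' : κ' ≤ κ) :
    FunctionalBound k w e Λ C' κ' := by
  intro i hi B hB ξ hξ
  have hB0 := nodeWeight_nonneg hw.1 i B
  calc |Λ (∑ a ∈ B, ξ a • e i a)| ≤ C * nodeWeight w i B ^ κ := h i hi B hB ξ hξ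
    _ ≤ C' * nodeWeight w i B ^ κ := by gcongr
    _ ≤ C' * nodeWeight w i B ^ κ' := by
      gcongr C' * ?_
      exact Real.rpow_le_rpow_of_exponent_ge' hB0 (nodeWeight_le_one hw hB) hκ' hκκ'

theorem inv_smul {c : ℝ} (hc : 0 < c) (h : FunctionalBound k w e Λ (C * c) κ) :
    FunctionalBound k w e (c⁻¹ • Λ) C κ := by
  intro i hi B hB ξ hξ
  rw [LinearMap.smul_apply, smul_eq_mul, abs_mul, abs_of_pos (inv_pos.mpr hc),
    inv_mul_le_iff₀ hc]
  exact (h i hi B hB ξ hξ).trans_eq (by ring)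

theorem sum_abs_le (h : FunctionalBound k w e Λ C κ) {i : ℕ} (hi : i < k) {B : Finset (ι × ℕ)}
    (hB : B ⊆ treeLevel ι i) : ∑ a ∈ B, |Λ (e i a)| ≤ C * nodeWeight w i B ^ κ := by
  choose η hη using fun a => exists_realSign_mul_eq_abs (Λ (e i a))
  have h := (le_abs_self _).trans (h i hi B hB (fun a => realSign (η a)) fun a => by simp)
  simpa [hη] using h

theorem sum_sq_le (hw : w ∈ stdSimplex ℝ ι) (hC : 0 ≤ C) (hκ : 0 ≤ κ)
    (h : FunctionalBound k w e Λ C κ) {i : ℕ} (hi : i < k) :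
    ∑ a ∈ treeLevel ι i, Λ (e i a) ^ 2 ≤ C ^ 2 * ((1 / 2 : ℝ) ^ i) ^ κ :=
  sum_sq_le_of_sum_abs_le hw hC hκ fun _ hB => h.sum_abs_le hi hB

end FunctionalBound

namespace FormBound

variable {β : V →ₗ[ℝ] V →ₗ[ℝ] ℝ} {C x y : ℝ}

theorem flip (h : FormBound k w e β C x y) : FormBound k w e β.flip C y x := by
  intro i hi B hB ξ hξ i' hi' B' hB' ζ hζ
  rw [LinearMap.flip_apply]
  exact (h i' hi' B' hB' ζ hζ i hi B hB ξ hξ).trans_eq (by ring)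

theorem inv_smul {c : ℝ} (hc : 0 < c) (h : FormBound k w e β (C * c) x y) :
    FormBound k w e (c⁻¹ • β) C x y := by
  intro i hi B hB ξ hξ
  rw [LinearMap.smul_apply]
  have hB_bound := h i hi B hB ξ hξ
  rw [mul_right_comm] at hB_bound
  exact hB_bound.inv_smul hc

theorem functionalBound_apply (hw : w ∈ stdSimplex ℝ ι) (h : FormBound k w e β C x y) (hC : 0 ≤ C)
    (hx : 0 ≤ x) {κ : ℝ} (hκ : 0 ≤ κ) (hy : κ ≤ y) {i : ℕ} (hi : i < k) {B : Finset (ι × ℕ)}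
    (hB : B ⊆ treeLevel ι i) {ξ : ι × ℕ → ℝ} (hξ : ∀ a, |ξ a| ≤ 1) :
    FunctionalBound k w e (β (∑ a ∈ B, ξ a • e i a)) C κ :=
  (h i hi B hB ξ hξ).mono hw
    (mul_le_of_le_one_right hC
      (Real.rpow_le_one (nodeWeight_nonneg hw.1 _ _) (nodeWeight_le_one hw hB) hx)) hC hκ hy

theorem sum_sq_le_of_half_le (hw : w ∈ stdSimplex ℝ ι) (hC : 0 ≤ C) (hx : 1 / 2 ≤ x) (hy : 0 ≤ y)
    (h : FormBound k w e β C x y) {i : ℕ} (hi : i < k) :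
    ∑ a ∈ treeLevel ι i, ∑ b ∈ treeLevel ι i, β (e i a) (e i b) ^ 2 ≤
      C ^ 2 * ((1 / 2 : ℝ) ^ i) ^ y := by
  have hrow : ∀ a ∈ treeLevel ι i, ∑ b ∈ treeLevel ι i, β (e i a) (e i b) ^ 2 ≤
      C ^ 2 * ((1 / 2 : ℝ) ^ i) ^ y * (w a.1 / 2 ^ i) := by
    intro a ha
    have ha' : {a} ⊆ treeLevel ι i := Finset.singleton_subset_iff.mpr ha
    have hμ := nodeWeight_nonneg hw.1 i {a}
    have hsq : (nodeWeight w i {a} ^ x) ^ 2 ≤ nodeWeight w i {a} := by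
      rw [← Real.rpow_natCast, ← Real.rpow_mul hμ]
      simpa using Real.rpow_le_rpow_of_exponent_ge' hμ (nodeWeight_le_one hw ha') zero_le_one
        (show 1 ≤ x * (2 : ℕ) by push_cast; linarith)
    have h1 : FunctionalBound k w e (β (e i a)) (C * nodeWeight w i {a} ^ x) y := by
      simpa using h i hi {a} ha' (fun _ => 1) (by simp)
    calc ∑ b ∈ treeLevel ι i, β (e i a) (e i b) ^ 2
        ≤ (C * nodeWeight w i {a} ^ x) ^ 2 * ((1 / 2 : ℝ) ^ i) ^ y :=
          h1.sum_sq_le hw (by positivity) hy hi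
      _ = C ^ 2 * ((1 / 2 : ℝ) ^ i) ^ y * (nodeWeight w i {a} ^ x) ^ 2 := by ring
      _ ≤ C ^ 2 * ((1 / 2 : ℝ) ^ i) ^ y * nodeWeight w i {a} := by gcongr
      _ = _ := by rw [nodeWeight_singleton]
  calc ∑ a ∈ treeLevel ι i, ∑ b ∈ treeLevel ι i, β (e i a) (e i b) ^ 2
      ≤ C ^ 2 * ((1 / 2 : ℝ) ^ i) ^ y * nodeWeight w i (treeLevel ι i) := by
        rw [nodeWeight, Finset.mul_sum]
        exact Finset.sum_le_sum hrow
    _ = _ := by rw [nodeWeight_treeLevel, hw.2, mul_one]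

theorem sum_sq_le (hw : w ∈ stdSimplex ℝ ι) (hC : 0 ≤ C) {κ : ℝ} (hκ : 0 ≤ κ) (hx : κ ≤ x)
    (hy : κ ≤ y) (hxy : x + y = 1) (h : FormBound k w e β C x y) {i : ℕ} (hi : i < k) :
    ∑ a ∈ treeLevel ι i, ∑ b ∈ treeLevel ι i, β (e i a) (e i b) ^ 2 ≤
      C ^ 2 * ((1 / 2 : ℝ) ^ i) ^ κ := by
  rcases le_total (1 / 2) x with hx2 | hx2
  · refine (h.sum_sq_le_of_half_le hw hC hx2 (hκ.trans hy) hi).trans ?_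
    gcongr C ^ 2 * ?_
    exact rpow_half_pow_le hy
  · rw [Finset.sum_comm]
    refine (h.flip.sum_sq_le_of_half_le hw hC (by linarith) (hκ.trans hx) hi).trans ?_
    gcongr C ^ 2 * ?_
    exact rpow_half_pow_le hx

/-- The diagonal sum of `η β`, with unimodular `η`, is an average of values of `β` at pairs of
signed sums over `B`. -/
theorem sum_abs_diag_le (hw : ∀ l, 0 ≤ w l) (hx : 0 ≤ x) (hy : 0 ≤ y) (hxy : x + y = 1)
    (h : FormBound k w e β C x y) {i : ℕ} (hi : i < k) {B : Finset (ι × ℕ)}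
    (hB : B ⊆ treeLevel ι i) : ∑ a ∈ B, |β (e i a) (e i a)| ≤ C * nodeWeight w i B := by
  choose η hη using fun a => exists_realSign_mul_eq_abs (β (e i a) (e i a))
  obtain ⟨σ, hσ⟩ := exists_signs_sum_diag_le B fun a b => realSign (η a) * β (e i a) (e i b)
  calc ∑ a ∈ B, |β (e i a) (e i a)|
      ≤ ∑ a ∈ B, ∑ b ∈ B, realSign (σ a) * realSign (σ b) *
          (realSign (η a) * β (e i a) (e i b)) := by simpa only [hη] using hσ
    _ = β (∑ a ∈ B, realSign (σ a * η a) • e i a) (∑ b ∈ B, realSign (σ b) • e i b) := by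
        simp only [map_sum, LinearMap.sum_apply, map_smul, LinearMap.smul_apply, smul_eq_mul,
          map_mul]
        rw [Finset.sum_comm]
        refine Finset.sum_congr rfl fun b _ => ?_
        rw [Finset.mul_sum]
        exact Finset.sum_congr rfl fun a _ => by ring
    _ ≤ C * nodeWeight w i B ^ x * nodeWeight w i B ^ y :=
        (le_abs_self _).trans (h i hi B hB _ (fun a => by simp) i hi B hB _ fun a => by simp)
    _ = C * nodeWeight w i B := by
        rw [mul_assoc, ← Real.rpow_add_of_nonneg (nodeWeight_nonneg hw i B) hx hy, hxy,
          Real.rpow_one]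

end FormBound

end FormBounds

section Balance

variable {ι V R : Type*} [Fintype ι] [AddCommGroup V] [Module ℝ V] {g : ℕ → ℕ}
  {σ τ : ℕ → ι × ℕ → ℤˣ} {e : ℕ → ι × ℕ → V} {β : V →ₗ[ℝ] V →ₗ[ℝ] ℝ}

/-- The signed sum `∑_{a ∈ block} ± e_a` of the vectors attached to a block. -/
def blockVec (g : ℕ → ℕ) (σ : ℕ → ι × ℕ → ℤˣ) (e : ℕ → ι × ℕ → V) (s j : ℕ) : V :=
  ∑ a ∈ block g σ s j, realSign (σ s a) • e (g s) a

/-- The trace of `β` over the vectors of level `i`. -/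
def diagSum (e : ℕ → ι × ℕ → V) (β : V →ₗ[ℝ] V →ₗ[ℝ] ℝ) (i : ℕ) : ℝ :=
  ∑ a ∈ treeLevel ι i, β (e i a) (e i a)

/-- The part of the trace of `β` over the vectors of level `g t` that lies below the block `j` of
level `g s`. -/
def blockDiagSum (g : ℕ → ℕ) (σ : ℕ → ι × ℕ → ℤˣ) (e : ℕ → ι × ℕ → V)
    (β : V →ₗ[ℝ] V →ₗ[ℝ] ℝ) (t s j : ℕ) : ℝ :=
  ∑ a ∈ treeLevel ι (g t) with label g σ s (ancestor (g t - g s) a) = j, β (e (g t) a) (e (g t) a)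

/-- The difference of the traces of `β` over the vectors of level `g t` below the left half and
below the right half of the node `b` of level `g s`. -/
def halfDiff [DecidableEq ι] (g : ℕ → ℕ) (e : ℕ → ι × ℕ → V) (β : V →ₗ[ℝ] V →ₗ[ℝ] ℝ) (t s : ℕ)
    (b : ι × ℕ) : ℝ :=
  ∑ a ∈ treeLevel ι (g t) with ancestor (g t - g s) a = b,
    realSign (halfSign (g t - g s - 1) a) * β (e (g t) a) (e (g t) a)

theorem blockVec_congr {s : ℕ} (h : ∀ t ≤ s, σ t = τ t) (j : ℕ) :
    blockVec g σ e s j = blockVec g τ e s j := by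
  rw [blockVec, blockVec, block_congr g (fun t ht => h t ht.le), h s le_rfl]

theorem form_blockVec_blockVec (s t j j' : ℕ) :
    β (blockVec g σ e s j) (blockVec g σ e t j') =
      ∑ a ∈ block g σ s j, ∑ b ∈ block g σ t j',
        realSign (σ s a) * realSign (σ t b) * β (e (g s) a) (e (g t) b) := by
  simp only [blockVec, map_sum, LinearMap.sum_apply, map_smul, LinearMap.smul_apply, smul_eq_mul,
    Finset.mul_sum]
  rw [Finset.sum_comm]
  exact Finset.sum_congr rfl fun a _ => Finset.sum_congr rfl fun b _ => by ring

theorem FormBound.abs_halfDiff_le [DecidableEq ι] {k : ℕ} {w : ι → ℝ} {C x y : ℝ}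
    (hw : ∀ l, 0 ≤ w l) (hx : 0 ≤ x) (hy : 0 ≤ y) (hxy : x + y = 1) (h : FormBound k w e β C x y)
    {s t : ℕ} (ht : g t < k) (hst : g s ≤ g t) {b : ι × ℕ} (hb : b ∈ treeLevel ι (g s)) :
    |halfDiff g e β t s b| ≤ C * (w b.1 / 2 ^ g s) := by
  rw [halfDiff, ← nodeWeight_filter_ancestor w hst hb]
  refine (Finset.abs_sum_le_sum_abs _ _).trans ?_
  simpa only [abs_mul, abs_realSign, one_mul] using
    h.sum_abs_diag_le hw hx hy hxy ht (Finset.filter_subset _ _)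

/-- A block of level `g (s + 1)` lies below the halves of the nodes of one block of level `g s` on
which the signed Haar functions take a given value. -/
theorem blockDiagSum_succ [DecidableEq ι] (hg : StrictMono g) {s t : ℕ} (hst : s < t) (j : ℕ) :
    blockDiagSum g σ e β t (s + 1) j = (blockDiagSum g σ e β t s (j / 2) +
      realSign ((-1) ^ j) *
        ∑ b ∈ block g σ s (j / 2), realSign (σ s b) * halfDiff g e β t s b) / 2 := by
  have hfib : ∑ b ∈ block g σ s (j / 2), realSign (σ s b) * halfDiff g e β t s b =
      ∑ a ∈ treeLevel ι (g t), if label g σ s (ancestor (g t - g s) a) = j / 2 then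
        realSign (halfSign (g t - g s - 1) a * σ s (ancestor (g t - g s) a)) *
          β (e (g t) a) (e (g t) a) else 0 := by
    rw [block, Finset.sum_filter, ← Finset.sum_fiberwise_of_maps_to (t := treeLevel ι (g s))
      (g := ancestor (g t - g s)) fun a ha => ancestor_mem_treeLevel (hg.monotone hst.le) ha]
    refine Finset.sum_congr rfl fun b _ => ?_
    split_ifs with hb
    · rw [halfDiff, Finset.mul_sum]
      refine Finset.sum_congr rfl fun a ha => ?_
      rw [(Finset.mem_filter.mp ha).2, if_pos hb, map_mul]
      ring
    · exact (Finset.sum_eq_zero fun a ha => by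
        rw [(Finset.mem_filter.mp ha).2, if_neg hb]).symm
  have hbit : ∀ (q : ℕ) (η : ℤˣ) (x : ℝ), (if 2 * q + (if η = 1 then 0 else 1) = j then x else 0) =
      ((if q = j / 2 then x else 0) +
        realSign ((-1) ^ j) * if q = j / 2 then realSign η * x else 0) / 2 := by
    intro q η x
    rcases Int.units_eq_one_or η with rfl | rfl <;>
    rcases Nat.even_or_odd' j with ⟨r, rfl | rfl⟩ <;>
    by_cases hq : q = r <;> simp [hq, pow_add, Nat.mul_add_div] <;> omega
  rw [hfib, blockDiagSum, blockDiagSum, Finset.mul_sum, Finset.sum_filter, Finset.sum_filter,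
    ← Finset.sum_add_distrib, Finset.sum_div]
  refine Finset.sum_congr rfl fun a _ => ?_
  rw [label_succ_ancestor hg σ hst, hbit]

/-- The conditions imposed on the signs of level `t`, given those of the previous levels: the block
vectors of level `t` are nearly annihilated by the functionals `Λ` and nearly `β`-orthogonal to each
other and to the earlier block vectors, their `β`-squares are close to the traces of `β` over their
blocks, and the traces of `β` over the later levels are nearly halved by the signed Haar functions
of the blocks of level `t`. -/
structure BalancedLevel [DecidableEq ι] (n : ℕ) (g : ℕ → ℕ) (e : ℕ → ι × ℕ → V)
    (β : V →ₗ[ℝ] V →ₗ[ℝ] ℝ) (Λ : R → V →ₗ[ℝ] ℝ) (δ : ℝ) (t : ℕ) (σ : ℕ → ι × ℕ → ℤˣ) : Prop where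
  functional : ∀ j < 2 ^ t, ∀ r, |Λ r (blockVec g σ e t j)| ≤ δ
  form_left : ∀ j < 2 ^ t, ∀ t' < t, ∀ j' < 2 ^ t',
    |β (blockVec g σ e t j) (blockVec g σ e t' j')| ≤ δ
  form_right : ∀ j < 2 ^ t, ∀ t' < t, ∀ j' < 2 ^ t',
    |β (blockVec g σ e t' j') (blockVec g σ e t j)| ≤ δ
  form_self : ∀ j < 2 ^ t, ∀ j' < 2 ^ t,
    |β (blockVec g σ e t j) (blockVec g σ e t j') -
      ∑ a ∈ treeLevel ι (g t) with label g σ t a = j ∧ label g σ t a = j',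
        β (e (g t) a) (e (g t) a)| ≤ δ
  halved : ∀ j < 2 ^ t, ∀ t', t < t' → t' < n →
    |∑ b ∈ block g σ t j, realSign (σ t b) * halfDiff g e β t' t b| ≤ δ

namespace BalancedLevel

variable [DecidableEq ι] {n : ℕ} {Λ : R → V →ₗ[ℝ] ℝ} {δ : ℝ}

theorem congr {t : ℕ} (h : BalancedLevel n g e β Λ δ t σ) (hστ : ∀ s ≤ t, σ s = τ s) :
    BalancedLevel n g e β Λ δ t τ := by
  have hvec : ∀ t' ≤ t, ∀ j, blockVec g σ e t' j = blockVec g τ e t' j := fun t' ht' =>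
    blockVec_congr fun s hs => hστ s (hs.trans ht')
  have hlabel : label g σ t = label g τ t := label_congr g fun s hs => hστ s hs.le
  constructor
  · simpa only [hvec t le_rfl] using h.functional
  · intro j hj t' ht' j' hj'
    simpa only [hvec t le_rfl, hvec t' ht'.le] using h.form_left j hj t' ht' j' hj'
  · intro j hj t' ht' j' hj'
    simpa only [hvec t le_rfl, hvec t' ht'.le] using h.form_right j hj t' ht' j' hj'
  · simpa only [hvec t le_rfl, hlabel] using h.form_self
  · simpa only [block, hlabel, hστ t le_rfl] using h.halved

theorem abs_blockDiagSum_sub_le (hg : StrictMono g) (h : ∀ t < n, BalancedLevel n g e β Λ δ t σ)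
    {s t : ℕ} (hst : s ≤ t) (ht : t < n) {j : ℕ} (hj : j < 2 ^ s) :
    |blockDiagSum g σ e β t s j - diagSum e β (g t) / 2 ^ s| ≤ s * δ := by
  induction s generalizing j with
  | zero =>
    obtain rfl : j = 0 := by simpa using hj
    simp [blockDiagSum, label, diagSum]
  | succ s ih =>
    have hj2 : j / 2 < 2 ^ s := by rw [pow_succ] at hj; omega
    have hδ := (h s (by omega)).halved (j / 2) hj2 t hst ht
    have hsum := abs_add_le (blockDiagSum g σ e β t s (j / 2) - diagSum e β (g t) / 2 ^ s)
      (realSign ((-1) ^ j) *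
        ∑ b ∈ block g σ s (j / 2), realSign (σ s b) * halfDiff g e β t s b)
    rw [abs_mul, abs_realSign, one_mul] at hsum
    have hδ0 : 0 ≤ δ := (abs_nonneg _).trans hδ
    have hs : 0 ≤ s * δ := mul_nonneg s.cast_nonneg hδ0
    rw [blockDiagSum_succ hg hst, pow_succ, ← div_div, ← sub_div, abs_div, abs_two,
      add_sub_right_comm]
    push_cast
    linarith [ih (by omega) hj2]

theorem abs_form_self_sub_le (hg : StrictMono g) (h : ∀ t < n, BalancedLevel n g e β Λ δ t σ)
    {t : ℕ} (ht : t < n) {j : ℕ} (hj : j < 2 ^ t) :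
    |β (blockVec g σ e t j) (blockVec g σ e t j) - diagSum e β (g t) / 2 ^ t| ≤ (t + 1) * δ := by
  have hself := (h t ht).form_self j hj j hj
  have hequi := abs_blockDiagSum_sub_le hg h le_rfl ht hj
  simp only [blockDiagSum, Nat.sub_self, ancestor_zero] at hequi
  simp only [and_self] at hself
  calc _ ≤ _ := abs_sub_le _ _ _
    _ ≤ δ + t * δ := add_le_add hself hequi
    _ = (t + 1) * δ := by ring

theorem abs_form_le (h : ∀ t < n, BalancedLevel n g e β Λ δ t σ) {t t' : ℕ} (ht : t < n)
    (ht' : t' < n) {j j' : ℕ} (hj : j < 2 ^ t) (hj' : j' < 2 ^ t') (hne : (t, j) ≠ (t', j')) :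
    |β (blockVec g σ e t j) (blockVec g σ e t' j')| ≤ δ := by
  rcases lt_trichotomy t t' with htt | rfl | htt
  · exact (h t' ht').form_right j' hj' t htt j hj
  · have hjj : j ≠ j' := fun h => hne (by rw [h])
    have hempty : ({a ∈ treeLevel ι (g t) | label g σ t a = j ∧ label g σ t a = j'}) = ∅ :=
      Finset.filter_eq_empty_iff.mpr fun a _ ha => hjj (ha.1.symm.trans ha.2)
    simpa [hempty] using (h t ht).form_self j hj j' hj'
  · exact (h t ht).form_left j hj t' htt j' hj'

end BalancedLevel

/-- The number of conditions on the signs of one level in `BalancedLevel`, for `r` functionals and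
`n` levels, weighted with the variance of the corresponding random sum. -/
def balanceCount (r n : ℕ) : ℕ := 2 ^ n * (r + (2 ^ n + 2 ^ n + n)) + 2 * (2 ^ n * 2 ^ n)

/-- The pairs `(s, j)` with `s < t` and `j < 2 ^ s`. They number the Haar functions in `L_p^{t,0}`,
and likewise the blocks of the levels `g s`, `s < t`. -/
abbrev HaarIndex (t : ℕ) : Type := Σ s : Fin t, Fin (2 ^ (s : ℕ))

theorem card_haarIndex_le {t n : ℕ} (h : t ≤ n) : Fintype.card (HaarIndex t) ≤ 2 ^ n := by
  simp only [Fintype.card_sigma, Fintype.card_fin]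
  rw [Fin.sum_univ_eq_sum_range fun s => 2 ^ s, Nat.geomSum_eq le_rfl]
  exact (Nat.div_le_self _ _).trans ((Nat.sub_le _ _).trans (Nat.pow_le_pow_right two_pos h))

/-- The functionals that the block vectors of level `t` are to be nearly annihilated by: the `Λ r`
and the pairings with the earlier block vectors. -/
def levelFunctional (g : ℕ → ℕ) (σ : ℕ → ι × ℕ → ℤˣ) (e : ℕ → ι × ℕ → V)
    (β : V →ₗ[ℝ] V →ₗ[ℝ] ℝ) (Λ : R → V →ₗ[ℝ] ℝ) (t : ℕ) :
    R ⊕ HaarIndex t ⊕ HaarIndex t → V →ₗ[ℝ] ℝ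
  | .inl r => Λ r
  | .inr (.inl q) => β.flip (blockVec g σ e q.1 q.2)
  | .inr (.inr q) => β (blockVec g σ e q.1 q.2)

theorem functionalBound_levelFunctional {k n : ℕ} (hgk : ∀ s < n, g s < k) {w : ι → ℝ}
    (hw : w ∈ stdSimplex ℝ ι) {C x y κ : ℝ} (hC : 0 ≤ C) (hκ : 0 ≤ κ) (hx : κ ≤ x) (hy : κ ≤ y)
    (hβ : FormBound k w e β C x y) {Λ : R → V →ₗ[ℝ] ℝ}
    (hΛ : ∀ r, FunctionalBound k w e (Λ r) C κ) {t : ℕ} (ht : t < n) (q) :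
    FunctionalBound k w e (levelFunctional g σ e β Λ t q) C κ := by
  rcases q with r | q | q
  · exact hΛ r
  · exact hβ.flip.functionalBound_apply hw hC (hκ.trans hy) hκ hx (hgk _ (q.1.2.trans ht))
      (block_subset _ _ _ _) fun a => by simp
  · exact hβ.functionalBound_apply hw hC (hκ.trans hx) hκ hy (hgk _ (q.1.2.trans ht))
      (block_subset _ _ _ _) fun a => by simp

theorem balancedLevel_update [DecidableEq ι] {n t : ℕ} {Λ : R → V →ₗ[ℝ] ℝ} {δ : ℝ}
    (σ : ℕ → ι × ℕ → ℤˣ) {ς : ι × ℕ → ℤˣ}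
    (hlin : ∀ j < 2 ^ t, ∀ q, |∑ a ∈ block g σ t j,
      realSign (ς a) * levelFunctional g σ e β Λ t q (e (g t) a)| ≤ δ)
    (hform : ∀ j < 2 ^ t, ∀ j' < 2 ^ t, |∑ a ∈ block g σ t j, ∑ b ∈ block g σ t j',
      realSign (ς a) * realSign (ς b) * β (e (g t) a) (e (g t) b) -
        ∑ a ∈ treeLevel ι (g t) with label g σ t a = j ∧ label g σ t a = j',
          β (e (g t) a) (e (g t) a)| ≤ δ)
    (hhalved : ∀ j < 2 ^ t, ∀ t', t < t' → t' < n →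
      |∑ a ∈ block g σ t j, realSign (ς a) * halfDiff g e β t' t a| ≤ δ) :
    BalancedLevel n g e β Λ δ t (Function.update σ t ς) := by
  have hlabel : label g (Function.update σ t ς) t = label g σ t :=
    label_congr g fun s hs => Function.update_of_ne hs.ne _ _
  have hearlier : ∀ t' < t, ∀ j, blockVec g (Function.update σ t ς) e t' j = blockVec g σ e t' j :=
    fun t' ht' => blockVec_congr fun s hs => Function.update_of_ne (hs.trans_lt ht').ne _ _
  have hvec : ∀ j, blockVec g (Function.update σ t ς) e t j =
      ∑ a ∈ block g σ t j, realSign (ς a) • e (g t) a := fun j => by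
    rw [blockVec, Function.update_self, block, hlabel, block]
  have hfunctional : ∀ j < 2 ^ t, ∀ q,
      |levelFunctional g σ e β Λ t q (blockVec g (Function.update σ t ς) e t j)| ≤ δ := by
    simpa only [hvec, map_sum, map_smul, smul_eq_mul] using hlin
  constructor
  · exact fun j hj r => hfunctional j hj (.inl r)
  · intro j hj t' ht' j' hj'
    rw [hearlier t' ht']
    exact hfunctional j hj (.inr (.inl ⟨⟨t', ht'⟩, ⟨j', hj'⟩⟩))
  · intro j hj t' ht' j' hj'
    rw [hearlier t' ht']
    exact hfunctional j hj (.inr (.inr ⟨⟨t', ht'⟩, ⟨j', hj'⟩⟩))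
  · simpa only [form_blockVec_blockVec, block, hlabel, Function.update_self] using hform
  · simpa only [block, hlabel, Function.update_self] using hhalved

theorem exists_signs_balancedLevel [DecidableEq ι] [Fintype R] {n k : ℕ} (hg : StrictMono g)
    (hgk : ∀ s < n, g s < k) {w : ι → ℝ} (hw : w ∈ stdSimplex ℝ ι) {C x y κ δ : ℝ} (hC : 0 ≤ C)
    (hκ : 0 ≤ κ) (hx : κ ≤ x) (hy : κ ≤ y) (hxy : x + y = 1) (hβ : FormBound k w e β C x y)
    {Λ : R → V →ₗ[ℝ] ℝ} (hΛ : ∀ r, FunctionalBound k w e (Λ r) C κ) (hδ : 0 ≤ δ) {t : ℕ}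
    (ht : t < n)
    (hsmall : balanceCount (Fintype.card R) n * (C ^ 2 * ((1 / 2 : ℝ) ^ g t) ^ κ) ≤ δ ^ 2)
    (σ : ℕ → ι × ℕ → ℤˣ) :
    ∃ ς : ι × ℕ → ℤˣ, BalancedLevel n g e β Λ δ t (Function.update σ t ς) := by
  set η := C ^ 2 * ((1 / 2 : ℝ) ^ g t) ^ κ
  have hη0 : 0 ≤ η := by positivity
  let ψ := levelFunctional g σ e β Λ t
  have hψ : ∀ q, ∑ a ∈ treeLevel ι (g t), ψ q (e (g t) a) ^ 2 ≤ η := fun q =>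
    (functionalBound_levelFunctional hgk hw hC hκ hx hy hβ hΛ ht q).sum_sq_le hw hC hκ (hgk t ht)
  have hhalf : ∀ t' : Finset.Ioo t n,
      ∑ a ∈ treeLevel ι (g t), halfDiff g e β t' t a ^ 2 ≤ η := by
    rintro ⟨t', ht'⟩
    obtain ⟨htt', ht'n⟩ := Finset.mem_Ioo.mp ht'
    refine (sum_sq_le_of_sum_abs_le hw hC zero_le_one fun B hB => ?_).trans
      (mul_le_mul_of_nonneg_left (rpow_half_pow_le (show κ ≤ 1 by linarith)) (sq_nonneg C))
    rw [Real.rpow_one, nodeWeight, Finset.mul_sum]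
    exact Finset.sum_le_sum fun a ha => hβ.abs_halfDiff_le hw.1 (hκ.trans hx) (hκ.trans hy) hxy
      (hgk t' ht'n) (hg.monotone htt'.le) (hB ha)
  have hcard : 2 ^ t * Fintype.card ((R ⊕ HaarIndex t ⊕ HaarIndex t) ⊕ Finset.Ioo t n) +
      2 * (2 ^ t * 2 ^ t) ≤ balanceCount (Fintype.card R) n := by
    have hIoo : n - t - 1 ≤ n := by omega
    have hpow : 2 ^ t ≤ 2 ^ n := Nat.pow_le_pow_right two_pos ht.le
    have hearlier := card_haarIndex_le ht.le
    simp only [Fintype.card_sum, Fintype.card_coe, Nat.card_Ioo, add_assoc, balanceCount]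
    gcongr
  obtain ⟨ς, hlin, hform⟩ := exists_signs_of_label (η := η) (δ := δ) (treeLevel ι (g t))
    (label g σ t) (2 ^ t)
    (Sum.elim (fun q a => ψ q (e (g t) a)) fun (t' : Finset.Ioo t n) a => halfDiff g e β t' t a)
    (fun a b => β (e (g t) a) (e (g t) b)) hδ (Sum.rec hψ hhalf)
    (hβ.sum_sq_le hw hC hκ hx hy hxy (hgk t ht))
    ((mul_le_mul_of_nonneg_right (mod_cast hcard) hη0).trans hsmall)
  exact ⟨ς, balancedLevel_update σ (fun j hj q => hlin j hj (.inl q)) hform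
    fun j hj t' htt' ht' => hlin j hj (.inr ⟨t', Finset.mem_Ioo.mpr ⟨htt', ht'⟩⟩)⟩

theorem exists_seq_of_forall_update {α : Type*} [Nonempty α] {P : ℕ → (ℕ → α) → Prop} {n : ℕ}
    (hcongr : ∀ t σ τ, P t σ → (∀ s ≤ t, σ s = τ s) → P t τ)
    (hupdate : ∀ t < n, ∀ σ, ∃ a, P t (Function.update σ t a)) : ∃ σ, ∀ t < n, P t σ := by
  induction n with
  | zero => exact ⟨fun _ => Classical.arbitrary α, by simp⟩
  | succ n ih =>
    obtain ⟨σ, hσ⟩ := ih fun t ht => hupdate t (by omega)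
    obtain ⟨a, ha⟩ := hupdate n n.lt_succ_self σ
    refine ⟨Function.update σ n a, fun t ht => ?_⟩
    rcases Nat.lt_succ_iff_lt_or_eq.mp ht with htn | rfl
    · exact hcongr t σ _ (hσ t htn) fun s hs =>
        (Function.update_of_ne (hs.trans_lt htn).ne _ _).symm
    · exact ha

theorem exists_balanced_signs [DecidableEq ι] [Fintype R] {n k : ℕ} (hg : StrictMono g)
    (hgk : ∀ s < n, g s < k) {w : ι → ℝ} (hw : w ∈ stdSimplex ℝ ι) {C x y κ δ : ℝ} (hC : 0 ≤ C)
    (hκ : 0 ≤ κ) (hx : κ ≤ x) (hy : κ ≤ y) (hxy : x + y = 1) (hβ : FormBound k w e β C x y)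
    {Λ : R → V →ₗ[ℝ] ℝ} (hΛ : ∀ r, FunctionalBound k w e (Λ r) C κ) (hδ : 0 ≤ δ)
    (hsmall : ∀ s < n,
      balanceCount (Fintype.card R) n * (C ^ 2 * ((1 / 2 : ℝ) ^ g s) ^ κ) ≤ δ ^ 2) :
    ∃ σ, ∀ t < n, BalancedLevel n g e β Λ δ t σ :=
  exists_seq_of_forall_update (fun _ _ _ h => h.congr) fun t ht =>
    exists_signs_balancedLevel hg hgk hw hC hκ hx hy hxy hβ hΛ hδ ht (hsmall t ht)

theorem exists_small_level (K C : ℝ) {κ δ : ℝ} (hκ : 0 < κ) (hδ : 0 < δ) :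
    ∃ M : ℕ, ∀ i ≥ M, K * (C ^ 2 * ((1 / 2 : ℝ) ^ i) ^ κ) ≤ δ ^ 2 := by
  have hpow : Filter.Tendsto (fun i : ℕ => ((1 / 2 : ℝ) ^ i) ^ κ) Filter.atTop (nhds 0) := by
    simpa [Real.zero_rpow hκ.ne'] using (tendsto_pow_atTop_nhds_zero_of_lt_one (r := (1 / 2 : ℝ))
      (by norm_num) (by norm_num)).rpow_const (p := κ) (Or.inr hκ.le)
  have hprod := (hpow.const_mul (C ^ 2)).const_mul K
  simp only [mul_zero] at hprod
  exact Filter.eventually_atTop.mp (hprod.eventually_le_const (by positivity))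

end Balance

section DyadicIndex

/-- The index of the dyadic interval of level `i` containing `x ≥ 0`. -/
noncomputable def dyadicIndex (i : ℕ) (x : ℝ) : ℕ := ⌊2 ^ i * x⌋₊

theorem measurable_dyadicIndex (i : ℕ) : Measurable (dyadicIndex i) :=
  Nat.measurable_floor.comp (measurable_const_mul _)

theorem mem_dyadic_iff {i j : ℕ} {x : ℝ} (hx : 0 ≤ x) : x ∈ dyadic i j ↔ dyadicIndex i x = j := by
  have hpos : (0 : ℝ) < 2 ^ i := by positivity
  rw [dyadicIndex, Nat.floor_eq_iff (by positivity), dyadic, Set.mem_Ico, div_le_iff₀ hpos,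
    lt_div_iff₀ hpos, mul_comm x]

theorem dyadicIndex_div (i d : ℕ) (x : ℝ) : dyadicIndex (i + d) x / 2 ^ d = dyadicIndex i x := by
  rw [dyadicIndex, dyadicIndex, ← Nat.floor_div_natCast]
  congr 1
  push_cast
  rw [pow_add]
  field_simp

theorem dyadicIndex_lt {i : ℕ} {x : ℝ} (hx : x ∈ Set.Ico 0 1) : dyadicIndex i x < 2 ^ i := by
  have hx0 := hx.1
  rw [dyadicIndex, Nat.floor_lt (by positivity)]
  push_cast
  exact mul_lt_of_lt_one_right (by positivity) hx.2

theorem ancestor_dyadicIndex {ι : Type*} {i i' : ℕ} (h : i ≤ i') (l : ι) (x : ℝ) :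
    ancestor (i' - i) (l, dyadicIndex i' x) = (l, dyadicIndex i x) := by
  obtain ⟨d, rfl⟩ := Nat.exists_eq_add_of_le h
  rw [Nat.add_sub_cancel_left, ancestor, dyadicIndex_div]

instance : IsProbabilityMeasure leb01 := ⟨by simp⟩

theorem ae_mem_Ico : ∀ᵐ x ∂leb01, x ∈ Set.Ico (0 : ℝ) 1 := by
  filter_upwards [ae_restrict_mem measurableSet_Icc, ae_restrict_of_ae (Measure.ae_ne volume 1)]
    with x hx hx1
  exact ⟨hx.1, lt_of_le_of_ne hx.2 hx1⟩

theorem leb01_dyadic {i j : ℕ} (hj : j < 2 ^ i) : leb01.real (dyadic i j) = (1 / 2 : ℝ) ^ i := by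
  have hpos : (0 : ℝ) < 2 ^ i := by positivity
  have hsub : dyadic i j ⊆ Set.Icc (0 : ℝ) 1 := fun x hx =>
    ⟨le_trans (by positivity) hx.1, hx.2.le.trans ((div_le_one hpos).mpr (mod_cast hj))⟩
  rw [measureReal_restrict_apply (show MeasurableSet (dyadic i j) from measurableSet_Ico),
    Set.inter_eq_left.mpr hsub, dyadic, Real.volume_real_Ico_of_le (by gcongr; linarith), one_div,
    inv_pow]
  field_simp
  ring

theorem leb01_dyadicIndex {i j : ℕ} (hj : j < 2 ^ i) :
    leb01.real {x | dyadicIndex i x = j} = (1 / 2 : ℝ) ^ i := by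
  rw [← leb01_dyadic hj]
  refine measureReal_congr ?_
  filter_upwards [ae_mem_Ico] with x hx
  exact propext (mem_dyadic_iff hx.1).symm

/-- The value of a Haar function `h_{[j/2^i, (j+1)/2^i)}` on the dyadic interval of level `i + 1`
with index `L`. -/
def haarValue (j L : ℕ) : ℝ := if L / 2 = j then (-1) ^ L else 0

theorem haarValue_eq_sub (j L : ℕ) :
    haarValue j L = (if L = 2 * j then 1 else 0) - if L = 2 * j + 1 then 1 else 0 := by
  rcases Nat.even_or_odd' L with ⟨q, rfl | rfl⟩
  · simp [haarValue, show 2 * q ≠ 2 * j + 1 by omega]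
  · by_cases h : q = j <;>
    simp [haarValue, show 2 * q + 1 ≠ 2 * j by omega, pow_add, Nat.mul_add_div, h]

theorem haarValue_two_mul_add (j q : ℕ) (η : ℤˣ) :
    haarValue j (2 * q + if η = 1 then 0 else 1) = if q = j then realSign η else 0 := by
  rcases Int.units_eq_one_or η with rfl | rfl <;>
  simp [haarValue, pow_add, Nat.mul_add_div]

theorem integral_haarValue {lb : ℝ → ℕ} (hlb : Measurable lb) (j : ℕ) :
    ∫ x, haarValue j (lb x) ∂leb01 =
      leb01.real {x | lb x = 2 * j} - leb01.real {x | lb x = 2 * j + 1} := by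
  have hm : ∀ L, MeasurableSet {x | lb x = L} := fun L => hlb (measurableSet_singleton L)
  have hint : ∀ L, Integrable ({x | lb x = L}.indicator (1 : ℝ → ℝ)) leb01 := fun L =>
    (integrable_const (1 : ℝ)).indicator (hm L)
  rw [← integral_indicator_one (hm _), ← integral_indicator_one (hm _),
    ← integral_sub (hint _) (hint _)]
  refine integral_congr_ae (ae_of_all _ fun x => ?_)
  simp [haarValue_eq_sub, Set.indicator_apply]

end DyadicIndex

section Haar

variable {p : ℝ≥0∞}

theorem coeFn_dyadicChi (i j : ℕ) :
    dyadicChi p i j =ᵐ[leb01] fun x => if dyadicIndex i x = j then (1 : ℝ) else 0 := by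
  have h : dyadicChi p i j =ᵐ[leb01] (dyadic i j).indicator fun _ => (1 : ℝ) :=
    indicatorConstLp_coeFn
  filter_upwards [h, ae_mem_Ico] with x hx h01
  classical
  rw [hx, Set.indicator_apply]
  exact if_congr (mem_dyadic_iff h01.1) rfl rfl

theorem coeFn_haar (i j : ℕ) :
    haar p i j =ᵐ[leb01] fun x => haarValue j (dyadicIndex (i + 1) x) := by
  have h : haar p i j =ᵐ[leb01]
    ⇑(dyadicChi p (i + 1) (2 * j)) - ⇑(dyadicChi p (i + 1) (2 * j + 1)) := Lp.coeFn_sub _ _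
  filter_upwards [h, coeFn_dyadicChi (p := p) (i + 1) (2 * j),
    coeFn_dyadicChi (p := p) (i + 1) (2 * j + 1)] with x hx hleft hright
  rw [hx, Pi.sub_apply, hleft, hright, haarValue_eq_sub]

theorem coeFn_haar_of_lt {t n : ℕ} (ht : t < n) (j : ℕ) :
    haar p t j =ᵐ[leb01] fun x => haarValue j (dyadicIndex n x / 2 ^ (n - (t + 1))) := by
  filter_upwards [coeFn_haar (p := p) t j] with x hx
  rw [hx, ← dyadicIndex_div (t + 1) (n - (t + 1)) x, Nat.add_sub_of_le ht]

theorem integral_haar {i j : ℕ} (hj : j < 2 ^ i) : ∫ x, haar p i j x ∂leb01 = 0 := by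
  rw [integral_congr_ae (coeFn_haar i j), integral_haarValue (measurable_dyadicIndex _),
    leb01_dyadicIndex (by rw [pow_succ]; omega), leb01_dyadicIndex (by rw [pow_succ]; omega),
    sub_self]

theorem LpHaar_le_LpZero [Fact (1 ≤ p)] (n : ℕ) : LpHaar p n ≤ LpZero p := by
  refine Submodule.span_le.mpr ?_
  rintro _ ⟨i, j, -, hj, rfl⟩
  exact integral_haar hj

/-- The Haar function of level `i` and index `K` in `L_p^{k,0}`, and zero if it does not belong to
this space. -/
noncomputable def haarMem (p : ℝ≥0∞) (k i K : ℕ) : LpHaar p k :=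
  if h : i < k ∧ K < 2 ^ i then haarIn p k ⟨i, h.1⟩ ⟨K, h.2⟩ else 0

theorem coe_haarMem {k i K : ℕ} (hi : i < k) (hK : K < 2 ^ i) :
    (haarMem p k i K : LpI p) = haar p i K := by
  rw [haarMem, dif_pos ⟨hi, hK⟩, haarIn]

/-- The Haar functions in a product of copies of `L_p^{k,0}`. -/
noncomputable def haarFamily {ι : Type*} [DecidableEq ι] (p : ℝ≥0∞) (k : ℕ) (i : ℕ) (a : ι × ℕ) :
    ι → LpHaar p k :=
  Pi.single a.1 (haarMem p k i a.2)

variable {ι : Type*} [Fintype ι] [DecidableEq ι]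

theorem coeFn_sum_haarFamily {k i : ℕ} (hi : i < k) {B : Finset (ι × ℕ)}
    (hB : B ⊆ treeLevel ι i) (ξ : ι × ℕ → ℝ) (l : ι) :
    ((∑ a ∈ B, ξ a • haarFamily p k i a : ι → LpHaar p k) l : LpI p) =ᵐ[leb01]
      fun x => if (l, dyadicIndex i x) ∈ B then
        ξ (l, dyadicIndex i x) * (-1) ^ dyadicIndex (i + 1) x else 0 := by
  have hcoe : ((∑ a ∈ B, ξ a • haarFamily p k i a : ι → LpHaar p k) l : LpI p) =
      ∑ a ∈ B, (if a.1 = l then ξ a else 0) • haar p i a.2 := by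
    rw [Finset.sum_apply, AddSubmonoidClass.coe_finsetSum]
    refine Finset.sum_congr rfl fun a ha => ?_
    by_cases hl : a.1 = l
    · simp [haarFamily, ← hl, coe_haarMem hi (mem_treeLevel.mp (hB ha))]
    · simp [haarFamily, hl]
  have hterm : ∀ᵐ x ∂leb01, ∀ a ∈ B, ((if a.1 = l then ξ a else 0) • haar p i a.2 : LpI p) x =
      if a = (l, dyadicIndex i x) then ξ a * (-1) ^ dyadicIndex (i + 1) x else 0 := by
    refine (Filter.eventually_all_finset B).mpr fun a _ => ?_
    filter_upwards [Lp.coeFn_smul (if a.1 = l then ξ a else 0) (haar p i a.2),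
      coeFn_haar (p := p) i a.2] with x hsmul hhaar
    have hparent := dyadicIndex_div i 1 x
    rw [pow_one] at hparent
    rw [hsmul, Pi.smul_apply, hhaar, haarValue, hparent, smul_eq_mul, ite_zero_mul_ite_zero]
    simp only [Prod.ext_iff, eq_comm]
  rw [hcoe]
  filter_upwards [Lp.coeFn_finsetSum B fun a => (if a.1 = l then ξ a else 0) • haar p i a.2, hterm]
    with x hsum hx
  rw [hsum, Finset.sum_apply, Finset.sum_congr rfl hx, Finset.sum_ite_eq']

/-- The label of the dyadic interval of level `g s` containing `x`, in the `l`-th copy of the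
dyadic tree. -/
noncomputable def pointLabel {ι : Type*} (g : ℕ → ℕ) (σ : ℕ → ι × ℕ → ℤˣ) (s : ℕ) (l : ι)
    (x : ℝ) : ℕ := label g σ s (l, dyadicIndex (g s) x)

section PointLabel

variable {ι : Type*} {g : ℕ → ℕ} (σ : ℕ → ι × ℕ → ℤˣ) (l : ι)

theorem measurable_pointLabel (g : ℕ → ℕ) (s : ℕ) : Measurable (pointLabel g σ s l) :=
  (measurable_from_nat (f := fun K => label g σ s (l, K))).comp (measurable_dyadicIndex _)

theorem pointLabel_lt (g : ℕ → ℕ) (s : ℕ) (x : ℝ) : pointLabel g σ s l x < 2 ^ s :=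
  label_lt g σ s _

theorem pointLabel_succ (hg : StrictMono g) (s : ℕ) (x : ℝ) :
    pointLabel g σ (s + 1) l x = 2 * pointLabel g σ s l x +
      if (-1) ^ dyadicIndex (g s + 1) x * σ s (l, dyadicIndex (g s) x) = 1 then 0 else 1 := by
  have hlt : g s < g (s + 1) := hg s.lt_succ_self
  have hhalf : halfSign (g (s + 1) - g s - 1) (l, dyadicIndex (g (s + 1)) x) =
      (-1) ^ dyadicIndex (g s + 1) x := by
    rw [halfSign, ← dyadicIndex_div (g s + 1) (g (s + 1) - g s - 1) x, Nat.sub_sub,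
      Nat.add_sub_of_le hlt]
  simp only [pointLabel, label, ancestor_dyadicIndex hlt.le, hhalf]

theorem pointLabel_add_div (hg : StrictMono g) (s d : ℕ) (x : ℝ) :
    pointLabel g σ (s + d) l x / 2 ^ d = pointLabel g σ s l x := by
  induction d with
  | zero => simp
  | succ d ih =>
    rw [← ih, pow_succ', ← Nat.div_div_eq_div_mul, ← add_assoc, pointLabel_succ σ l hg]
    congr 1
    split_ifs <;> omega

end PointLabel

theorem coeFn_blockVec_haarFamily {k : ℕ} {g : ℕ → ℕ} (hg : StrictMono g)
    (σ : ℕ → ι × ℕ → ℤˣ) {t : ℕ} (ht : g t < k) (j : ℕ) (l : ι) :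
    (blockVec g σ (haarFamily p k) t j l : LpI p) =ᵐ[leb01]
      fun x => haarValue j (pointLabel g σ (t + 1) l x) := by
  filter_upwards [coeFn_sum_haarFamily (p := p) ht (block_subset g σ t j)
    (fun a => realSign (σ t a)) l, ae_mem_Ico] with x hx h01
  have hmem : (l, dyadicIndex (g t) x) ∈ block g σ t j ↔ pointLabel g σ t l x = j := by
    rw [block, Finset.mem_filter, mem_treeLevel]
    exact and_iff_right (dyadicIndex_lt h01)
  rw [blockVec, hx, pointLabel_succ σ l hg, haarValue_two_mul_add]
  refine if_congr hmem ?_ rfl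
  rw [map_mul, mul_comm, map_pow, realSign_neg, map_one]

theorem leb01_pointLabel {ι : Type*} [Finite ι] {g : ℕ → ℕ} (hg : StrictMono g)
    (σ : ℕ → ι × ℕ → ℤˣ) (l : ι) {s j : ℕ} (hj : j < 2 ^ s) :
    leb01.real {x | pointLabel g σ s l x = j} = (1 / 2 : ℝ) ^ s := by
  classical
  cases nonempty_fintype ι
  induction s generalizing j with
  | zero =>
    obtain rfl : j = 0 := by simpa using hj
    simp [pointLabel, label]
  | succ s ih =>
    have hq : j / 2 < 2 ^ s := by rw [pow_succ] at hj; omega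
    set q := j / 2 with hjq
    have hparent : ∀ x, pointLabel g σ (s + 1) l x / 2 = pointLabel g σ s l x := fun x => by
      simpa using pointLabel_add_div σ l hg s 1 x
    have hsum : leb01.real {x | pointLabel g σ (s + 1) l x = 2 * q} +
        leb01.real {x | pointLabel g σ (s + 1) l x = 2 * q + 1} = (1 / 2 : ℝ) ^ s := by
      have hm : MeasurableSet {x | pointLabel g σ (s + 1) l x = 2 * q + 1} :=
        measurable_pointLabel σ l g (s + 1) (measurableSet_singleton _)
      have hdisj : Disjoint {x | pointLabel g σ (s + 1) l x = 2 * q}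
          {x | pointLabel g σ (s + 1) l x = 2 * q + 1} :=
        Set.disjoint_left.mpr fun x hx hx' => by simp_all
      rw [← ih hq, ← measureReal_union hdisj hm]
      congr 1
      ext x
      have := hparent x
      simp only [Set.mem_union, Set.mem_ofPred_eq]
      omega
    have hdiff : leb01.real {x | pointLabel g σ (s + 1) l x = 2 * q} -
        leb01.real {x | pointLabel g σ (s + 1) l x = 2 * q + 1} = 0 := by
      rw [← integral_haarValue (measurable_pointLabel σ l g (s + 1)), ← integral_congr_ae
        (coeFn_blockVec_haarFamily (p := 1) hg σ (g s).lt_succ_self q l)]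
      exact LpHaar_le_LpZero _ (Subtype.property _)
    rcases (by omega : j = 2 * q ∨ j = 2 * q + 1) with h | h <;>
    rw [h, pow_succ] <;> linarith

end Haar
section Relabel

variable {p : ℝ≥0∞}

/-- The average of a function over the dyadic interval `[L/2^n, (L+1)/2^n)`, `L < 2^n`. -/
noncomputable def dyadicAverage (n L : ℕ) (f : LpI p) : ℝ :=
  2 ^ n * ∫ x in dyadic n L, f x ∂leb01

theorem dyadicAverage_smul (n L : ℕ) (c : ℝ) (f : LpI p) :
    dyadicAverage n L (c • f) = c * dyadicAverage n L f := by
  rw [dyadicAverage, integral_congr_ae (ae_restrict_of_ae (Lp.coeFn_smul c f)), dyadicAverage]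
  simp only [Pi.smul_apply, smul_eq_mul, integral_const_mul]
  ring

theorem dyadicAverage_eq {n L : ℕ} (hL : L < 2 ^ n) {f : LpI p} {φ : ℕ → ℝ}
    (h : f =ᵐ[leb01] fun x => φ (dyadicIndex n x)) : dyadicAverage n L f = φ L := by
  have hconst : ∫ x in dyadic n L, f x ∂leb01 = ∫ _ in dyadic n L, φ L ∂leb01 := by
    refine setIntegral_congr_ae measurableSet_Ico ?_
    filter_upwards [h, ae_mem_Ico] with x hx h01 hxL
    rw [hx, (mem_dyadic_iff h01.1).mp hxL]
  rw [dyadicAverage, hconst, setIntegral_const, leb01_dyadic hL, smul_eq_mul, one_div, inv_pow]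
  field_simp

theorem LpHaar_eq_dyadicAverage {n : ℕ} {f : LpI p} (hf : f ∈ LpHaar p n) :
    f =ᵐ[leb01] fun x => dyadicAverage n (dyadicIndex n x) f := by
  obtain ⟨φ, hφ⟩ : ∃ φ : ℕ → ℝ, f =ᵐ[leb01] fun x => φ (dyadicIndex n x) := by
    induction hf using Submodule.span_induction with
    | mem f hf =>
      obtain ⟨t, j, ht, -, rfl⟩ := hf
      exact ⟨fun L => haarValue j (L / 2 ^ (n - (t + 1))), coeFn_haar_of_lt ht j⟩
    | zero => exact ⟨fun _ => 0, Lp.coeFn_zero ℝ p leb01⟩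
    | add f g _ _ hf hg =>
      obtain ⟨φ, hφ⟩ := hf
      obtain ⟨ψ, hψ⟩ := hg
      exact ⟨fun L => φ L + ψ L, (Lp.coeFn_add f g).trans (hφ.add hψ)⟩
    | smul c f _ hf =>
      obtain ⟨φ, hφ⟩ := hf
      exact ⟨fun L => c • φ L, (Lp.coeFn_smul c f).trans (hφ.const_smul c)⟩
  filter_upwards [hφ, ae_mem_Ico] with x hx h01
  rw [hx, dyadicAverage_eq (dyadicIndex_lt h01) hφ]

theorem map_eq_map_dyadicIndex {n : ℕ} {lb : ℝ → ℕ} (hlb : Measurable lb)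
    (hlt : ∀ x, lb x < 2 ^ n)
    (huniform : ∀ L < 2 ^ n, leb01.real {x | lb x = L} = (1 / 2 : ℝ) ^ n) :
    leb01.map lb = leb01.map (dyadicIndex n) := by
  refine Measure.ext_of_singleton fun L => ?_
  rw [Measure.map_apply hlb (measurableSet_singleton L),
    Measure.map_apply (measurable_dyadicIndex n) (measurableSet_singleton L)]
  by_cases hL : L < 2 ^ n
  · exact (measureReal_eq_measureReal_iff (measure_ne_top _ _) (measure_ne_top _ _)).mp
      ((huniform L hL).trans (leb01_dyadicIndex hL).symm)
  · refine measure_congr ?_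
    filter_upwards [ae_mem_Ico] with x hx
    exact propext ⟨fun h => absurd (hlt x) (h ▸ hL), fun h => absurd (dyadicIndex_lt hx) (h ▸ hL)⟩

variable [Fact (1 ≤ p)]

theorem integrable_coeFn (f : LpI p) : Integrable f leb01 := (Lp.memLp f).integrable Fact.out

theorem dyadicAverage_add (n L : ℕ) (f g : LpI p) :
    dyadicAverage n L (f + g) = dyadicAverage n L f + dyadicAverage n L g := by
  rw [dyadicAverage, integral_congr_ae (ae_restrict_of_ae (Lp.coeFn_add f g))]
  simp only [Pi.add_apply]
  rw [integral_add (integrable_coeFn f).integrableOn (integrable_coeFn g).integrableOn, mul_add]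
  rfl

/-- The operator that moves the average of `f` over the dyadic interval of level `n` and index `L`
to the set of all `x` with label `lb x = L`. -/
noncomputable def relabel (n : ℕ) (lb : ℝ → ℕ) (hlb : Measurable lb) : LpI p →ₗ[ℝ] LpI p where
  toFun f := ∑ L ∈ Finset.range (2 ^ n), dyadicAverage n L f •
    indicatorConstLp p (s := {x | lb x = L}) (μ := leb01) (hlb (measurableSet_singleton L))
      (measure_ne_top _ _) (1 : ℝ)
  map_add' f g := by
    simp only [dyadicAverage_add, add_smul, Finset.sum_add_distrib]
  map_smul' c f := by
    simp only [dyadicAverage_smul, mul_smul, Finset.smul_sum, RingHom.id_apply]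

theorem coeFn_relabel {n : ℕ} {lb : ℝ → ℕ} (hlb : Measurable lb) (hlt : ∀ x, lb x < 2 ^ n)
    (f : LpI p) : relabel n lb hlb f =ᵐ[leb01] fun x => dyadicAverage n (lb x) f := by
  set u : ℕ → LpI p := fun L =>
    indicatorConstLp p (s := {x | lb x = L}) (μ := leb01) (hlb (measurableSet_singleton L))
      (measure_ne_top _ _) (1 : ℝ)
  have hterm : ∀ᵐ x ∂leb01, ∀ L ∈ Finset.range (2 ^ n), (dyadicAverage n L f • u L : LpI p) x =
      if lb x = L then dyadicAverage n L f else 0 := by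
    refine (Filter.eventually_all_finset _).mpr fun L _ => ?_
    have hu : u L =ᵐ[leb01] {x | lb x = L}.indicator fun _ => (1 : ℝ) := indicatorConstLp_coeFn
    filter_upwards [Lp.coeFn_smul (dyadicAverage n L f) (u L), hu] with x hsmul hx
    simp [hsmul, hx, Set.indicator_apply]
  filter_upwards [Lp.coeFn_finsetSum (Finset.range (2 ^ n)) fun L => dyadicAverage n L f • u L,
    hterm] with x hsum hx
  refine hsum.trans ?_
  rw [Finset.sum_apply, Finset.sum_congr rfl hx, Finset.sum_ite_eq,
    if_pos (Finset.mem_range.mpr (hlt x))]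

theorem distr_relabel {n : ℕ} {lb : ℝ → ℕ} (hlb : Measurable lb) (hlt : ∀ x, lb x < 2 ^ n)
    (huniform : ∀ L < 2 ^ n, leb01.real {x | lb x = L} = (1 / 2 : ℝ) ^ n) {f : LpI p}
    (hf : f ∈ LpHaar p n) : distr (relabel n lb hlb f) = distr f := by
  have hφ : Measurable fun L => dyadicAverage n L f := measurable_from_nat
  calc distr (relabel n lb hlb f)
      = leb01.map ((fun L => dyadicAverage n L f) ∘ lb) :=
        Measure.map_congr (coeFn_relabel hlb hlt f)
    _ = leb01.map ((fun L => dyadicAverage n L f) ∘ dyadicIndex n) := by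
        rw [← Measure.map_map hφ hlb, map_eq_map_dyadicIndex hlb hlt huniform,
          Measure.map_map hφ (measurable_dyadicIndex n)]
    _ = distr f := (Measure.map_congr (LpHaar_eq_dyadicAverage hf)).symm

variable {ι : Type*} [Fintype ι] [DecidableEq ι] {n k : ℕ} {g : ℕ → ℕ}

theorem relabel_haar (hg : StrictMono g) (hgk : ∀ s < n, g s < k) (σ : ℕ → ι × ℕ → ℤˣ) (l : ι)
    {t : ℕ} (ht : t < n) (j : ℕ) :
    relabel n (pointLabel g σ n l) (measurable_pointLabel σ l g n) (haar p t j) =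
      (blockVec g σ (haarFamily p k) t j l : LpI p) := by
  refine Lp.ext ?_
  filter_upwards [coeFn_relabel (measurable_pointLabel σ l g n) (pointLabel_lt σ l g n)
    (haar p t j), coeFn_blockVec_haarFamily (p := p) hg σ (hgk t ht) j l] with x hrelabel hblock
  rw [hrelabel, hblock, dyadicAverage_eq (φ := fun L => haarValue j (L / 2 ^ (n - (t + 1))))
      (pointLabel_lt σ l g n x) (coeFn_haar_of_lt ht j),
    ← pointLabel_add_div σ l hg (t + 1) (n - (t + 1)) x, Nat.add_sub_of_le ht]

theorem exists_distEmbedding (hg : StrictMono g) (hgk : ∀ s < n, g s < k)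
    (σ : ℕ → ι × ℕ → ℤˣ) (l : ι) :
    ∃ J : LpHaar p n →ₗ[ℝ] LpHaar p k, IsDistEmbedding J ∧
      ∀ t < n, ∀ j < 2 ^ t, J (haarMem p n t j) = blockVec g σ (haarFamily p k) t j l := by
  set J₀ : LpI p →ₗ[ℝ] LpI p :=
    relabel n (pointLabel g σ n l) (measurable_pointLabel σ l g n) with hJ
  have hle : LpHaar p n ≤ (LpHaar p k).comap J₀ := by
    refine Submodule.span_le.mpr ?_
    rintro _ ⟨t, j, ht, -, rfl⟩
    rw [SetLike.mem_coe, Submodule.mem_comap, hJ, relabel_haar hg hgk σ l ht j]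
    exact Subtype.property _
  refine ⟨J₀.restrict hle, fun f => ?_, fun t ht j hj => Subtype.ext ?_⟩
  · exact distr_relabel (measurable_pointLabel σ l g n) (pointLabel_lt σ l g n)
      (fun L hL => leb01_pointLabel hg σ l hL) f.2
  · rw [LinearMap.coe_restrict_apply, coe_haarMem ht hj]
    exact relabel_haar hg hgk σ l ht j

end Relabel

section Distribution

variable {p : ℝ≥0∞}

theorem measurable_coeFn (u : LpI p) : Measurable u := (Lp.stronglyMeasurable u).measurable

theorem distr_apply (u : LpI p) {B : Set ℝ} (hB : MeasurableSet B) :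
    distr u B = leb01 {x | u x ∈ B} :=
  Measure.map_apply (measurable_coeFn u) hB

instance (u : LpI p) : IsProbabilityMeasure (distr u) :=
  Measure.isProbabilityMeasure_map (measurable_coeFn u).aemeasurable

theorem distr_compl_zero_toReal (u : LpI p) :
    (distr u {0}ᶜ).toReal = leb01.real {x | u x ≠ 0} := by
  rw [distr_apply u (measurableSet_singleton 0).compl]
  rfl

theorem ae_abs_le_iff_distr_eq_zero {u : LpI p} {C : ℝ} :
    (∀ᵐ x ∂leb01, |u x| ≤ C) ↔ distr u {y | C < |y|} = 0 := by
  rw [distr_apply u (measurableSet_lt measurable_const measurable_abs), ae_iff]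
  simp only [not_le, Set.mem_ofPred_eq]

variable {U V X : Submodule ℝ (LpI p)}

namespace IsCompression

variable {θ : ℝ} {S : V →ₗ[ℝ] X}

theorem distr_apply_of_zero_notMem (hS : IsCompression θ S) (f : V) {B : Set ℝ}
    (hB : MeasurableSet B) (h0 : (0 : ℝ) ∉ B) :
    distr (S f : LpI p) B = ENNReal.ofReal θ * distr (f : LpI p) B := by
  rw [hS.2.2 f]
  simp [Measure.dirac_apply' _ hB, h0]

theorem of_distr_eq (hθ0 : 0 < θ) (hθ1 : θ ≤ 1)
    (h : ∀ (f : V) (B : Set ℝ), MeasurableSet B → (0 : ℝ) ∉ B →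
      distr (S f : LpI p) B = ENNReal.ofReal θ * distr (f : LpI p) B) : IsCompression θ S := by
  refine ⟨hθ0, hθ1, fun f => ?_⟩
  set ν : Measure ℝ :=
    ENNReal.ofReal θ • distr (f : LpI p) + ENNReal.ofReal (1 - θ) • Measure.dirac 0 with hν
  have : IsProbabilityMeasure ν := by
    constructor
    simp only [hν, Measure.add_apply, Measure.smul_apply, smul_eq_mul, mul_one, measure_univ]
    rw [← ENNReal.ofReal_add hθ0.le (by linarith)]
    simp
  have hout : ∀ B, MeasurableSet B → (0 : ℝ) ∉ B → distr (S f : LpI p) B = ν B :=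
    fun B hB h0 => by
      rw [h f B hB h0]
      simp [hν, Measure.dirac_apply' _ hB, h0]
  ext B hB
  by_cases h0 : (0 : ℝ) ∈ B
  · have hcompl := hout Bᶜ hB.compl (by simpa using h0)
    rwa [prob_compl_eq_one_sub hB, prob_compl_eq_one_sub hB,
      ENNReal.sub_right_inj ENNReal.one_ne_top prob_le_one prob_le_one] at hcompl
  · exact hout B hB h0

theorem ae_abs_le (hS : IsCompression θ S) {f : V} {C : ℝ} (hC : 0 ≤ C)
    (hf : ∀ᵐ x ∂leb01, |(f : LpI p) x| ≤ C) : ∀ᵐ x ∂leb01, |(S f : LpI p) x| ≤ C := by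
  rw [ae_abs_le_iff_distr_eq_zero] at hf ⊢
  rw [hS.distr_apply_of_zero_notMem f (measurableSet_lt measurable_const measurable_abs)
    (by simpa using hC), hf, mul_zero]

theorem measureReal_support (hS : IsCompression θ S) (f : V) :
    leb01.real {x | (S f : LpI p) x ≠ 0} = θ * leb01.real {x | (f : LpI p) x ≠ 0} := by
  rw [← distr_compl_zero_toReal, hS.distr_apply_of_zero_notMem f
    (measurableSet_singleton 0).compl (by simp), ENNReal.toReal_mul,
    ENNReal.toReal_ofReal hS.1.le, distr_compl_zero_toReal]

end IsCompression

end Distribution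

section Joint

variable {p : ℝ≥0∞} {N : ℕ} {U V X : Submodule ℝ (LpI p)}

/-- The operator `(F_l)_l ↦ ∑_l S_l F_l` on the product of `N` copies of the common domain of the
operators `S_l`. -/
noncomputable def joint (S : Fin N → (V →ₗ[ℝ] X)) : (Fin N → V) →ₗ[ℝ] X :=
  ∑ l, S l ∘ₗ LinearMap.proj l

theorem joint_apply (S : Fin N → (V →ₗ[ℝ] X)) (F : Fin N → V) : joint S F = ∑ l, S l (F l) := by
  simp [joint]

theorem assembled_apply (S : Fin N → (V →ₗ[ℝ] X)) (J : Fin N → (U →ₗ[ℝ] V)) (f : U) :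
    assembled S J f = joint S fun l => J l f := by
  simp [assembled, joint_apply]

theorem coeFn_joint (S : Fin N → (V →ₗ[ℝ] X)) (F : Fin N → V) :
    (joint S F : LpI p) =ᵐ[leb01] fun x => ∑ l, (S l (F l) : LpI p) x := by
  rw [joint_apply, AddSubmonoidClass.coe_finsetSum]
  filter_upwards [Lp.coeFn_finsetSum Finset.univ fun l => (S l (F l) : LpI p)] with x hx
  rw [hx, Finset.sum_apply]

theorem sum_mem_iff_exists_mem {ι : Type*} [Fintype ι] {x : ι → ℝ}
    (hx : Pairwise fun l l' => x l = 0 ∨ x l' = 0) {B : Set ℝ} (h0 : (0 : ℝ) ∉ B) :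
    ∑ l, x l ∈ B ↔ ∃ l, x l ∈ B := by
  by_cases h : ∃ l, x l ≠ 0
  · obtain ⟨l, hl⟩ := h
    have hzero : ∀ l', l' ≠ l → x l' = 0 := fun l' hl' => (hx hl').resolve_right hl
    rw [Fintype.sum_eq_single l hzero]
    refine ⟨fun hB => ⟨l, hB⟩, fun ⟨l', hl'⟩ => ?_⟩
    by_cases hne : l' = l
    · rwa [← hne]
    · exact absurd (hzero l' hne ▸ hl') h0
  · push Not at h
    simp [h, h0]

variable {S : Fin N → (V →ₗ[ℝ] X)} {θ : Fin N → ℝ}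

theorem DisjointRanges.ae_eq_zero (hd : DisjointRanges S) (F : Fin N → V) :
    ∀ᵐ x ∂leb01, Pairwise fun l l' => (S l (F l) : LpI p) x = 0 ∨ (S l' (F l') : LpI p) x = 0 := by
  obtain ⟨A, hA, hdisj⟩ := hd
  have hsupp : ∀ l, ∀ᵐ x ∂leb01, (S l (F l) : LpI p) x ≠ 0 → x ∈ A l := fun l =>
    (hA l).2.1 _ ⟨F l, rfl⟩
  have hnotMem : ∀ l l', ∀ᵐ x ∂leb01, l ≠ l' → x ∉ A l ∩ A l' := fun l l' =>
    Filter.eventually_imp_distrib_left.mpr fun h =>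
      measure_eq_zero_iff_ae_notMem.mp (hdisj l l' h)
  filter_upwards [ae_all_iff.mpr hsupp, ae_all_iff.mpr fun l => ae_all_iff.mpr (hnotMem l)]
    with x hx hx' l l' hne
  by_contra! h
  exact hx' l l' hne ⟨hx l h.1, hx l' h.2⟩

theorem distr_joint (hd : DisjointRanges S) (hS : ∀ l, IsCompression (θ l) (S l)) (F : Fin N → V)
    {B : Set ℝ} (hB : MeasurableSet B) (h0 : (0 : ℝ) ∉ B) :
    distr (joint S F : LpI p) B = ∑ l, ENNReal.ofReal (θ l) * distr (F l : LpI p) B := by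
  have hunion : {x | (joint S F : LpI p) x ∈ B} =ᵐ[leb01] ⋃ l, {x | (S l (F l) : LpI p) x ∈ B} := by
    filter_upwards [hd.ae_eq_zero F, coeFn_joint S F] with x hx hsum
    have hiff : (joint S F : LpI p) x ∈ B ↔ x ∈ ⋃ l, {x | (S l (F l) : LpI p) x ∈ B} := by
      rw [hsum, sum_mem_iff_exists_mem hx h0, Set.mem_iUnion]
      rfl
    exact propext hiff
  have hdisj : Pairwise fun l l' =>
      AEDisjoint leb01 {x | (S l (F l) : LpI p) x ∈ B} {x | (S l' (F l') : LpI p) x ∈ B} := by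
    refine fun l l' hne => measure_eq_zero_iff_ae_notMem.mpr ?_
    filter_upwards [hd.ae_eq_zero F] with x hx hmem
    rcases hx hne with h | h
    · exact h0 (h ▸ hmem.1)
    · exact h0 (h ▸ hmem.2)
  rw [distr_apply _ hB, measure_congr hunion, measure_iUnion₀ hdisj fun l =>
    (measurable_coeFn _ hB).nullMeasurableSet, tsum_fintype]
  refine Finset.sum_congr rfl fun l _ => ?_
  rw [← distr_apply _ hB, (hS l).distr_apply_of_zero_notMem (F l) hB h0]

theorem joint_ae_abs_le (hd : DisjointRanges S) (hS : ∀ l, IsCompression (θ l) (S l))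
    {F : Fin N → V} {C : ℝ} (hC : 0 ≤ C) (hF : ∀ l, ∀ᵐ x ∂leb01, |(F l : LpI p) x| ≤ C) :
    ∀ᵐ x ∂leb01, |(joint S F : LpI p) x| ≤ C := by
  simp only [ae_abs_le_iff_distr_eq_zero] at hF ⊢
  rw [distr_joint hd hS F (measurableSet_lt measurable_const measurable_abs) (by simpa using hC)]
  simp [hF]

theorem joint_measureReal_support (hd : DisjointRanges S) (hS : ∀ l, IsCompression (θ l) (S l))
    (F : Fin N → V) : leb01.real {x | (joint S F : LpI p) x ≠ 0} =
      ∑ l, θ l * leb01.real {x | (F l : LpI p) x ≠ 0} := by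
  rw [← distr_compl_zero_toReal,
    distr_joint hd hS F (measurableSet_singleton 0).compl (by simp),
    ENNReal.toReal_sum fun l _ => ENNReal.mul_ne_top ENNReal.ofReal_ne_top (measure_ne_top _ _)]
  refine Finset.sum_congr rfl fun l _ => ?_
  rw [ENNReal.toReal_mul, ENNReal.toReal_ofReal (hS l).1.le, distr_compl_zero_toReal]

theorem sum_le_one_of_disjointRanges {k : ℕ} (hk : 0 < k) {S : Fin N → (LpHaar p k →ₗ[ℝ] X)}
    (hd : DisjointRanges S) (hS : ∀ l, IsCompression (θ l) (S l)) : ∑ l, θ l ≤ 1 := by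
  have hfull : leb01.real {x | (haarMem p k 0 0 : LpI p) x ≠ 0} = 1 := by
    rw [← probReal_univ (μ := leb01), coe_haarMem hk one_pos]
    refine measureReal_congr ?_
    filter_upwards [coeFn_haar (p := p) 0 0, ae_mem_Ico] with x hx h01
    have hlt : dyadicIndex 1 x < 2 := dyadicIndex_lt h01
    have hne : haar p 0 0 x ≠ 0 := by
      rw [hx, haarValue, if_pos (Nat.div_eq_of_lt hlt)]
      positivity
    exact propext ⟨fun _ => trivial, fun _ => hne⟩
  have hsupp := joint_measureReal_support hd hS fun _ => haarMem p k 0 0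
  simp only [hfull, mul_one] at hsupp
  exact hsupp ▸ measureReal_le_one

theorem isCompression_assembled (hd : DisjointRanges S) (hS : ∀ l, IsCompression (θ l) (S l))
    (hθ0 : 0 < ∑ l, θ l) (hθ1 : ∑ l, θ l ≤ 1) {J : Fin N → (U →ₗ[ℝ] V)}
    (hJ : ∀ l, IsDistEmbedding (J l)) : IsCompression (∑ l, θ l) (assembled S J) := by
  refine IsCompression.of_distr_eq hθ0 hθ1 fun f B hB h0 => ?_
  rw [assembled_apply, distr_joint hd hS _ hB h0,
    ENNReal.ofReal_sum_of_nonneg fun l _ => (hS l).1.le, Finset.sum_mul]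
  exact Finset.sum_congr rfl fun l _ => by rw [hJ l f]

end Joint

section Pairing

variable {p : ℝ≥0∞}

theorem pairing_comm (f g : LpI p) : pairing f g = pairing g f := by
  simp only [pairing, mul_comm]

theorem pairing_smul_right (c : ℝ) (f u : LpI p) : pairing f (c • u) = c * pairing f u := by
  rw [pairing, pairing, ← integral_const_mul]
  refine integral_congr_ae ?_
  filter_upwards [Lp.coeFn_smul c u] with x hx
  rw [hx, Pi.smul_apply, smul_eq_mul, mul_left_comm]

theorem pairing_smul_left (c : ℝ) (f u : LpI p) : pairing (c • f) u = c * pairing f u := by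
  rw [pairing_comm, pairing_smul_right, pairing_comm]

theorem pairing_self_eq_integral_distr (u : LpI p) : pairing u u = ∫ y, y ^ 2 ∂distr u := by
  rw [distr, integral_map (measurable_coeFn u).aemeasurable (by fun_prop)]
  simp only [pairing, sq]

theorem memLp_top_of_mem_LpHaar {n : ℕ} {f : LpI p} (hf : f ∈ LpHaar p n) : MemLp f ∞ leb01 := by
  refine memLp_top_of_bound (measurable_coeFn f).aestronglyMeasurable
    (∑ L ∈ Finset.range (2 ^ n), |dyadicAverage n L f|) ?_
  filter_upwards [LpHaar_eq_dyadicAverage hf, ae_mem_Ico] with x hx h01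
  rw [hx, Real.norm_eq_abs]
  exact Finset.single_le_sum (f := fun L => |dyadicAverage n L f|) (fun _ _ => abs_nonneg _)
    (Finset.mem_range.mpr (dyadicIndex_lt h01))

theorem pairing_haar_of_lt {t t' j j' : ℕ} (htt' : t < t') (hj' : j' < 2 ^ t') :
    pairing (haar p t j) (haar p t' j') = 0 := by
  set c := haarValue j (j' / 2 ^ (t' - (t + 1)))
  calc pairing (haar p t j) (haar p t' j') = ∫ x, c * haar p t' j' x ∂leb01 := by
        refine integral_congr_ae ?_
        filter_upwards [coeFn_haar_of_lt (p := p) htt' j, coeFn_haar (p := p) t' j'] with x hx hx'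
        have hparent := dyadicIndex_div t' 1 x
        rw [pow_one] at hparent
        rw [hx, hx', haarValue, haarValue, hparent]
        by_cases h : dyadicIndex t' x = j' <;> simp [h, c, haarValue]
    _ = 0 := by rw [integral_const_mul, integral_haar hj', mul_zero]

theorem pairing_haar_self {t j : ℕ} (hj : j < 2 ^ t) :
    pairing (haar p t j) (haar p t j) = (1 / 2) ^ t := by
  have hm : MeasurableSet {x | dyadicIndex t x = j} :=
    measurable_dyadicIndex t (measurableSet_singleton j)
  rw [← leb01_dyadicIndex hj, ← integral_indicator_one hm]
  refine integral_congr_ae ?_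
  filter_upwards [coeFn_haar (p := p) t j] with x hx
  have hparent := dyadicIndex_div t 1 x
  rw [pow_one] at hparent
  by_cases h : dyadicIndex t x = j <;> simp [hx, haarValue, hparent, h, ← mul_pow]

theorem pairing_haar_of_ne {t t' j j' : ℕ} (hj : j < 2 ^ t) (hj' : j' < 2 ^ t')
    (hne : (t, j) ≠ (t', j')) : pairing (haar p t j) (haar p t' j') = 0 := by
  rcases lt_trichotomy t t' with h | rfl | h
  · exact pairing_haar_of_lt h hj'
  · rw [pairing, integral_eq_zero_of_ae]
    filter_upwards [coeFn_haar (p := p) t j, coeFn_haar (p := p) t j'] with x hx hx'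
    rw [hx, hx', haarValue, haarValue]
    split_ifs <;> simp_all
  · rw [pairing_comm, pairing_haar_of_lt h hj]

variable [Fact (1 ≤ p)]

instance : Fact (1 ≤ p.conjExponent) := ⟨ENNReal.HolderConjugate.one_le _ p⟩

/-- The functional `f ↦ ⟨f, u⟩` on `L_p`, for a bounded function `u`. -/
noncomputable def pairingCLM (u : LpI p) (hu : MemLp u ∞ leb01) : LpI p →L[ℝ] ℝ :=
  ((ContinuousLinearMap.mul ℝ ℝ).lpPairing leb01 p p.conjExponent).flip
    ((hu.mono_exponent le_top).toLp u)

theorem pairingCLM_apply {u : LpI p} (hu : MemLp u ∞ leb01) (f : LpI p) :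
    pairingCLM u hu f = pairing f u := by
  rw [pairingCLM, ContinuousLinearMap.flip_apply, ContinuousLinearMap.lpPairing_eq_integral]
  refine integral_congr_ae ?_
  filter_upwards [(hu.mono_exponent le_top : MemLp u p.conjExponent leb01).coeFn_toLp] with x hx
  rw [hx, ContinuousLinearMap.mul_apply']

theorem pairing_add_left {u : LpI p} (hu : MemLp u ∞ leb01) (f g : LpI p) :
    pairing (f + g) u = pairing f u + pairing g u := by
  simp only [← pairingCLM_apply hu, map_add]

theorem pairing_add_right {u v : LpI p} (hu : MemLp u ∞ leb01) (hv : MemLp v ∞ leb01)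
    (f : LpI p) : pairing f (u + v) = pairing f u + pairing f v := by
  have hint : ∀ {u : LpI p}, MemLp u ∞ leb01 → Integrable (fun x => f x * u x) leb01 := fun hu =>
    (Lp.memLp f).integrable_mul (hu.mono_exponent le_top : MemLp _ p.conjExponent leb01)
  rw [pairing, pairing, pairing, ← integral_add (hint hu) (hint hv)]
  refine integral_congr_ae ?_
  filter_upwards [Lp.coeFn_add u v] with x hx
  rw [hx, Pi.add_apply, mul_add]

theorem pairing_add_self {u v : LpI p} (hu : MemLp u ∞ leb01) (hv : MemLp v ∞ leb01)
    (huv : MemLp (u + v : LpI p) ∞ leb01) :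
    pairing (u + v) (u + v) = pairing u u + 2 * pairing u v + pairing v v := by
  rw [pairing_add_left huv, pairing_comm u, pairing_comm v, pairing_add_left hu,
    pairing_add_left hv, pairing_comm v u]
  ring

theorem abs_pairing_le_mul_eLpNorm {u : LpI p} (hu : MemLp u ∞ leb01) (f : LpI p) :
    |pairing f u| ≤ ‖f‖ * (eLpNorm u p.conjExponent leb01).toReal := by
  have hu' : MemLp u p.conjExponent leb01 := hu.mono_exponent le_top
  calc |pairing f u| ≤ ∫ x, |f x * u x| ∂leb01 := abs_integral_le_integral_abs
    _ = (eLpNorm (⇑f • ⇑u) 1 leb01).toReal := by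
        rw [eLpNorm_one_eq_lintegral_enorm, ← integral_norm_eq_lintegral_enorm
          ((measurable_coeFn f).smul (measurable_coeFn u)).aestronglyMeasurable]
        rfl
    _ ≤ (eLpNorm f p leb01 * eLpNorm u p.conjExponent leb01).toReal :=
        ENNReal.toReal_mono (ENNReal.mul_ne_top (Lp.eLpNorm_ne_top f) hu'.eLpNorm_ne_top)
          (eLpNorm_smul_le_mul_eLpNorm hu'.1 (Lp.memLp f).1)
    _ = ‖f‖ * (eLpNorm u p.conjExponent leb01).toReal := by rw [ENNReal.toReal_mul, Lp.norm_def]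

end Pairing

section Compression

variable {p : ℝ≥0∞} {X V : Submodule ℝ (LpI p)} {θ : ℝ} {S : V →ₗ[ℝ] X}

theorem IsCompression.memLp_top (hS : IsCompression θ S) {f : V} (hf : MemLp (f : LpI p) ∞ leb01) :
    MemLp (S f : LpI p) ∞ leb01 := by
  have hbound : ∀ᵐ x ∂leb01, |(f : LpI p) x| ≤ (eLpNormEssSup (f : LpI p) leb01).toReal := by
    filter_upwards [ae_le_eLpNormEssSup (f := (f : LpI p)) (μ := leb01)] with x hx
    rw [← Real.norm_eq_abs, ← toReal_enorm]
    exact ENNReal.toReal_mono (eLpNorm_exponent_top (f := (f : LpI p)) ▸ hf.2.ne) hx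
  exact memLp_top_of_bound (measurable_coeFn _).aestronglyMeasurable _
    (hS.ae_abs_le ENNReal.toReal_nonneg hbound)

theorem IsCompression.pairing_self (hS : IsCompression θ S) {f : V}
    (hf : MemLp (f : LpI p) ∞ leb01) :
    pairing (S f : LpI p) (S f) = θ * pairing (f : LpI p) f := by
  have hint : Integrable (fun y : ℝ => y ^ 2) (distr (f : LpI p)) := by
    rw [distr, integrable_map_measure (by fun_prop) (measurable_coeFn _).aemeasurable]
    exact (hf.mono_exponent le_top : MemLp (f : LpI p) 2 leb01).integrable_sq
  rw [pairing_self_eq_integral_distr, pairing_self_eq_integral_distr, hS.2.2 f,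
    integral_add_measure (hint.smul_measure ENNReal.ofReal_ne_top)
      ((integrable_dirac (by simp)).smul_measure ENNReal.ofReal_ne_top),
    integral_smul_measure, integral_smul_measure, integral_dirac, ENNReal.toReal_ofReal hS.1.le]
  simp

theorem IsCompression.pairing_eq [Fact (1 ≤ p)] (hS : IsCompression θ S) {f g : V}
    (hf : MemLp (f : LpI p) ∞ leb01) (hg : MemLp (g : LpI p) ∞ leb01) :
    pairing (S f : LpI p) (S g) = θ * pairing (f : LpI p) g := by
  have hfg : MemLp (f + g : LpI p) ∞ leb01 := (hf.add hg).ae_eq (Lp.coeFn_add _ _).symm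
  have hSfg := hS.memLp_top (f := f + g) hfg
  have hsq := hS.pairing_self (f := f + g) hfg
  rw [map_add] at hSfg hsq
  rw [Submodule.coe_add, Submodule.coe_add, pairing_add_self (hS.memLp_top hf) (hS.memLp_top hg)
    hSfg, pairing_add_self hf hg hfg, hS.pairing_self hf, hS.pairing_self hg] at hsq
  linarith

end Compression

section UnitSupported

variable {p : ℝ≥0∞}

/-- Functions with values in `[-1, 1]` that vanish outside a set of measure at most `M`. These are
the functions whose `L_p`-norms and pairings are controlled by the measure of the support alone. -/
structure UnitSupported (u : LpI p) (M : ℝ) : Prop where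
  ae_abs_le_one : ∀ᵐ x ∂leb01, |u x| ≤ 1
  measureReal_support_le : leb01.real {x | u x ≠ 0} ≤ M

namespace UnitSupported

variable {u : LpI p} {M : ℝ}

theorem memLp_top (h : UnitSupported u M) : MemLp u ∞ leb01 :=
  memLp_top_of_bound (measurable_coeFn u).aestronglyMeasurable 1 h.ae_abs_le_one

theorem eLpNorm_toReal_le (h : UnitSupported u M) (q : ℝ≥0∞) :
    (eLpNorm u q leb01).toReal ≤ M ^ q.toReal⁻¹ := by
  set A := {x | u x ≠ 0}
  have hbound : eLpNorm u q leb01 ≤ leb01 A ^ q.toReal⁻¹ := by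
    rw [← eLpNorm_restrict_eq_of_support_subset (s := A) (fun x hx => hx)]
    simpa using eLpNorm_le_of_ae_bound (p := q) (μ := leb01.restrict A) (f := (u : ℝ → ℝ)) (C := 1)
      (ae_restrict_of_ae h.ae_abs_le_one)
  have hq : (0 : ℝ) ≤ q.toReal⁻¹ := inv_nonneg.mpr ENNReal.toReal_nonneg
  calc (eLpNorm u q leb01).toReal ≤ (leb01 A ^ q.toReal⁻¹).toReal :=
        ENNReal.toReal_mono (ENNReal.rpow_ne_top_of_nonneg hq (measure_ne_top _ _)) hbound
    _ = leb01.real A ^ q.toReal⁻¹ := by rw [← ENNReal.toReal_rpow, measureReal_def]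
    _ ≤ M ^ q.toReal⁻¹ := Real.rpow_le_rpow measureReal_nonneg h.measureReal_support_le hq

theorem norm_le (h : UnitSupported u M) : ‖u‖ ≤ M ^ p.toReal⁻¹ := by
  rw [Lp.norm_def]
  exact h.eLpNorm_toReal_le p

theorem abs_pairing_le [Fact (1 ≤ p)] (h : UnitSupported u M) (f : LpI p) :
    |pairing f u| ≤ M ^ (1 - p.toReal⁻¹) * ‖f‖ := by
  have hconj : p.conjExponent.toReal⁻¹ = 1 - p.toReal⁻¹ := by
    rw [← ENNReal.toReal_inv, ← ENNReal.toReal_inv, ← ENNReal.HolderConjugate.one_sub_inv p,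
      ENNReal.toReal_sub_of_le (ENNReal.inv_le_one.mpr Fact.out) ENNReal.one_ne_top,
      ENNReal.toReal_one]
  rw [mul_comm, ← hconj]
  exact (abs_pairing_le_mul_eLpNorm h.memLp_top f).trans
    (mul_le_mul_of_nonneg_left (h.eLpNorm_toReal_le _) (norm_nonneg f))

end UnitSupported

theorem IsCompression.unitSupported {V X : Submodule ℝ (LpI p)} {θ M : ℝ} {S : V →ₗ[ℝ] X}
    (hS : IsCompression θ S) {f : V} (hf : UnitSupported (f : LpI p) M) :
    UnitSupported (S f : LpI p) (θ * M) where
  ae_abs_le_one := hS.ae_abs_le zero_le_one hf.ae_abs_le_one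
  measureReal_support_le := by
    rw [hS.measureReal_support]
    exact mul_le_mul_of_nonneg_left hf.measureReal_support_le hS.1.le

theorem unitSupported_haar (i j : ℕ) : UnitSupported (haar p i j) 1 where
  ae_abs_le_one := by
    filter_upwards [coeFn_haar (p := p) i j] with x hx
    rw [hx, haarValue]
    split_ifs <;> simp
  measureReal_support_le := measureReal_le_one

section HaarSum

variable {ι : Type*} [Fintype ι] [DecidableEq ι] {k i : ℕ} {B : Finset (ι × ℕ)}

theorem ae_abs_sum_haarFamily_le_one (hi : i < k) (hB : B ⊆ treeLevel ι i) {ξ : ι × ℕ → ℝ}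
    (hξ : ∀ a, |ξ a| ≤ 1) (l : ι) :
    ∀ᵐ x ∂leb01, |((∑ a ∈ B, ξ a • haarFamily p k i a : ι → LpHaar p k) l : LpI p) x| ≤ 1 := by
  filter_upwards [coeFn_sum_haarFamily (p := p) hi hB ξ l] with x hx
  rw [hx]
  split_ifs
  · simpa [abs_mul] using hξ _
  · simp

theorem measureReal_support_sum_haarFamily_le (hi : i < k) (hB : B ⊆ treeLevel ι i)
    (ξ : ι × ℕ → ℝ) (l : ι) :
    leb01.real {x | ((∑ a ∈ B, ξ a • haarFamily p k i a : ι → LpHaar p k) l : LpI p) x ≠ 0} ≤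
      ∑ a ∈ B with a.1 = l, (1 / 2) ^ i := by
  set A := {x | ((∑ a ∈ B, ξ a • haarFamily p k i a : ι → LpHaar p k) l : LpI p) x ≠ 0}
  set A' := ⋃ a ∈ B.filter fun a => a.1 = l, {x | dyadicIndex i x = a.2}
  have hsub : ∀ᵐ x ∂leb01, x ∈ A → x ∈ A' := by
    filter_upwards [coeFn_sum_haarFamily (p := p) hi hB ξ l] with x hx hne
    have hmem : (l, dyadicIndex i x) ∈ B := by
      by_contra h
      exact hne (hx.trans (if_neg h))
    exact Set.mem_biUnion (Finset.mem_filter.mpr ⟨hmem, rfl⟩) rfl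
  calc leb01.real A ≤ leb01.real A' :=
        ENNReal.toReal_mono (measure_ne_top _ _) (measure_mono_ae hsub)
    _ ≤ ∑ a ∈ B with a.1 = l, leb01.real {x | dyadicIndex i x = a.2} :=
        measureReal_biUnion_finset_le _ _
    _ = ∑ a ∈ B with a.1 = l, (1 / 2) ^ i := Finset.sum_congr rfl fun a ha =>
        leb01_dyadicIndex (mem_treeLevel.mp (hB (Finset.mem_filter.mp ha).1))

end HaarSum

theorem unitSupported_joint_sum {k N i : ℕ} {X : Submodule ℝ (LpI p)}
    {S : Fin N → (LpHaar p k →ₗ[ℝ] X)} (hd : DisjointRanges S) {θ : Fin N → ℝ}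
    (hS : ∀ l, IsCompression (θ l) (S l)) (hi : i < k) {B : Finset (Fin N × ℕ)}
    (hB : B ⊆ treeLevel (Fin N) i) {ξ : Fin N × ℕ → ℝ} (hξ : ∀ a, |ξ a| ≤ 1) :
    UnitSupported (joint S (∑ a ∈ B, ξ a • haarFamily p k i a) : LpI p) (nodeWeight θ i B) where
  ae_abs_le_one := joint_ae_abs_le hd hS zero_le_one (ae_abs_sum_haarFamily_le_one hi hB hξ)
  measureReal_support_le := by
    rw [joint_measureReal_support hd hS, nodeWeight,
      ← Finset.sum_fiberwise B Prod.fst fun a => θ a.1 / 2 ^ i]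
    refine Finset.sum_le_sum fun l _ => ?_
    have hweight : ∑ a ∈ B with a.1 = l, θ a.1 / 2 ^ i =
        θ l * ∑ a ∈ B with a.1 = l, (1 / 2) ^ i := by
      rw [Finset.mul_sum]
      refine Finset.sum_congr rfl fun a ha => ?_
      rw [(Finset.mem_filter.mp ha).2, one_div, inv_pow, div_eq_mul_inv]
    rw [hweight]
    exact mul_le_mul_of_nonneg_left (measureReal_support_sum_haarFamily_le hi hB ξ l) (hS l).1.le

end UnitSupported

section Projection

theorem starProjection_span_range {𝕜 E ι : Type*} [RCLike 𝕜] [NormedAddCommGroup E]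
    [InnerProductSpace 𝕜 E] [Fintype ι] {z : ι → E}
    [(Submodule.span 𝕜 (Set.range z)).HasOrthogonalProjection] (hz : ∀ i, z i ≠ 0)
    (horth : Pairwise fun i j => inner 𝕜 (z i) (z j) = 0) (f : E) :
    (Submodule.span 𝕜 (Set.range z)).starProjection f =
      ∑ i, (inner 𝕜 (z i) f / inner 𝕜 (z i) (z i)) • z i := by
  refine Submodule.eq_starProjection_of_mem_orthogonal (Submodule.sum_mem _ fun i _ =>
    Submodule.smul_mem _ _ (Submodule.subset_span (Set.mem_range_self i))) ?_
  have hortho : ∀ j, inner 𝕜 (z j)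
      (f - ∑ i, (inner 𝕜 (z i) f / inner 𝕜 (z i) (z i)) • z i) = 0 := by
    intro j
    rw [inner_sub_right, inner_sum, Finset.sum_eq_single j
      (fun i _ hij => by rw [inner_smul_right, horth hij.symm, mul_zero]) (by simp),
      inner_smul_right, div_mul_cancel₀ _ (inner_self_ne_zero.mpr (hz j)), sub_self]
  rw [Submodule.mem_orthogonal]
  intro u hu
  induction hu using Submodule.span_induction with
  | mem u hu => obtain ⟨j, rfl⟩ := hu; exact hortho j
  | zero => exact inner_zero_left _
  | add u v _ _ hu hv => rw [inner_add_left, hu, hv, add_zero]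
  | smul c u _ hu => rw [inner_smul_left, hu, mul_zero]

theorem inner_eq_pairing {p : ℝ≥0∞} {f g : LpI 2} {u v : LpI p} (hf : f =ᵐ[leb01] u)
    (hg : g =ᵐ[leb01] v) : inner ℝ f g = pairing v u := by
  rw [L2.inner_def]
  refine integral_congr_ae ?_
  filter_upwards [hf, hg] with x hx hx'
  rw [hx, hx', RCLike.inner_apply, conj_trivial]

variable {p : ℝ≥0∞} [Fact (1 ≤ p)]

/-- A pairwise orthogonal system of bounded functions with `⟨y i, y i⟩ = c i`. The constants `A`
and `B` bound the functionals `⟨·, y i⟩` and the functions `y i` in `L_p`, and `K` compares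
`A * B` with the `c i`; norm bounds for the orthogonal projection onto the span only involve `K`
and the number of functions. -/
structure OrthSystem {ι : Type*} (y : ι → LpI p) (c : ι → ℝ) (A B K : ℝ) : Prop where
  pos : ∀ i, 0 < c i
  memLp_top : ∀ i, MemLp (y i) ∞ leb01
  pairing_self : ∀ i, pairing (y i) (y i) = c i
  pairing_eq_zero : Pairwise fun i j => pairing (y i) (y j) = 0
  abs_pairing_le : ∀ i f, |pairing f (y i)| ≤ A * ‖f‖
  norm_le : ∀ i, ‖y i‖ ≤ B
  nonneg : 0 ≤ K
  mul_le : ∀ i, A * B ≤ K * c i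

variable {ι : Type*} [Fintype ι] {Y : Submodule ℝ (LpI p)} {y : ι → Y} {c : ι → ℝ} {A B K : ℝ}

/-- The orthogonal projection onto the span of an orthogonal system, as an operator on `L_p`. -/
noncomputable def orthProj (h : OrthSystem (fun i => (y i : LpI p)) c A B K) : LpI p →L[ℝ] Y :=
  ∑ i, (c i)⁻¹ • (pairingCLM (y i : LpI p) (h.memLp_top i)).smulRight (y i)

theorem orthProj_apply (h : OrthSystem (fun i => (y i : LpI p)) c A B K) (f : LpI p) :
    orthProj h f = ∑ i, (pairing f (y i) / c i) • y i := by
  simp only [orthProj, sum_apply, smul_apply, ContinuousLinearMap.smulRight_apply,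
    pairingCLM_apply, smul_smul, div_eq_inv_mul]

theorem orthProj_coe (h : OrthSystem (fun i => (y i : LpI p)) c A B K)
    (hY : Submodule.span ℝ (Set.range y) = ⊤) (v : Y) : orthProj h v = v := by
  have hv : v ∈ Submodule.span ℝ (Set.range y) := hY ▸ Submodule.mem_top
  induction hv using Submodule.span_induction with
  | mem v hv =>
    obtain ⟨j, rfl⟩ := hv
    rw [orthProj_apply, Finset.sum_eq_single j
      (fun i _ hij => by rw [h.pairing_eq_zero hij.symm, zero_div, zero_smul]) (by simp),
      h.pairing_self, div_self (h.pos j).ne', one_smul]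
  | zero => simp
  | add u v _ _ hu hv => rw [Submodule.coe_add, map_add, hu, hv]
  | smul a v _ hv => rw [Submodule.coe_smul, map_smul, hv]

theorem isOrthProj_orthProj (h : OrthSystem (fun i => (y i : LpI p)) c A B K)
    (hY : Submodule.span ℝ (Set.range y) = ⊤) : IsOrthProj Y (orthProj h) := by
  set z : ι → LpI 2 := fun i => ((h.memLp_top i).mono_exponent le_top).toLp (y i : LpI p)
  have hz : ∀ i, z i =ᵐ[leb01] (y i : LpI p) := fun i => MemLp.coeFn_toLp _
  have hself : ∀ i, inner ℝ (z i) (z i) = c i := fun i =>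
    (inner_eq_pairing (hz i) (hz i)).trans (h.pairing_self i)
  have hne : ∀ i, z i ≠ 0 := fun i => inner_self_ne_zero.mp ((hself i).trans_ne (h.pos i).ne')
  have horth : Pairwise fun i j => inner ℝ (z i) (z j) = 0 := fun i j hij =>
    (inner_eq_pairing (hz i) (hz j)).trans (h.pairing_eq_zero hij.symm)
  have : FiniteDimensional ℝ (Submodule.span ℝ (Set.range z)) :=
    FiniteDimensional.span_of_finite ℝ (Set.finite_range z)
  refine ⟨fun v => ⟨v, orthProj_coe h hY v⟩,
    (Submodule.span ℝ (Set.range z)).starProjection, isStarProjection_starProjection,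
    fun f g hfg => ?_⟩
  have hcoeff : ∀ i, inner ℝ (z i) g = pairing f (y i : LpI p) := fun i =>
    inner_eq_pairing (hz i) hfg.symm
  rw [orthProj_apply, starProjection_span_range hne horth, AddSubmonoidClass.coe_finsetSum]
  refine (Lp.coeFn_finsetSum _ _).trans (Filter.EventuallyEq.trans ?_ (Lp.coeFn_finsetSum _ _).symm)
  refine eventuallyEq_sum fun i _ => ?_
  rw [hself, hcoeff, Submodule.coe_smul]
  exact (Lp.coeFn_smul _ _).trans (((hz i).symm.const_smul _).trans (Lp.coeFn_smul _ _).symm)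

end Projection

section ProjectionBounds

theorem norm_comp_subtypeL_le {𝕜 E F : Type*} [NontriviallyNormedField 𝕜]
    [SeminormedAddCommGroup E] [SeminormedAddCommGroup F] [NormedSpace 𝕜 E] [NormedSpace 𝕜 F]
    (Y : Submodule 𝕜 E) (R : E →L[𝕜] F) : ‖R ∘L Y.subtypeL‖ ≤ ‖R‖ :=
  (R.opNorm_comp_le _).trans
    (mul_le_of_le_one_right (ContinuousLinearMap.opNorm_nonneg R) Y.norm_subtypeL_le)

variable {p : ℝ≥0∞} [Fact (1 ≤ p)] {ι : Type*} [Fintype ι] {Y : Submodule ℝ (LpI p)} {y : ι → Y}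
  {c : ι → ℝ} {A B K a : ℝ}

theorem norm_orthProj_apply_le (h : OrthSystem (fun i => (y i : LpI p)) c A B K) {f : LpI p}
    (ha : 0 ≤ a) (hf : ∀ i, |pairing f (y i)| ≤ a * A) :
    ‖orthProj h f‖ ≤ Fintype.card ι * K * a := by
  rw [orthProj_apply, mul_assoc, ← nsmul_eq_mul]
  refine norm_sum_le_of_le _ (fun i _ => ?_) |>.trans_eq (Finset.sum_const _)
  rw [norm_smul, Real.norm_eq_abs, abs_div, abs_of_pos (h.pos i), div_mul_eq_mul_div,
    div_le_iff₀ (h.pos i)]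
  calc |pairing f (y i)| * ‖y i‖ ≤ a * A * B :=
        mul_le_mul (hf i) (h.norm_le i) (norm_nonneg _) ((abs_nonneg _).trans (hf i))
    _ ≤ a * (K * c i) := by rw [mul_assoc]; exact mul_le_mul_of_nonneg_left (h.mul_le i) ha
    _ = K * a * c i := by ring

theorem norm_orthProj_comp_le {Z : Type*} [SeminormedAddCommGroup Z] [NormedSpace ℝ Z]
    (h : OrthSystem (fun i => (y i : LpI p)) c A B K) (Q : Z →L[ℝ] LpI p) (ha : 0 ≤ a)
    (hQ : ∀ z i, |pairing (Q z) (y i)| ≤ a * ‖z‖ * A) :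
    ‖orthProj h ∘L Q‖ ≤ Fintype.card ι * K * a := by
  have := h.nonneg
  refine ContinuousLinearMap.opNorm_le_bound _ (by positivity) fun z => ?_
  rw [mul_assoc]
  exact norm_orthProj_apply_le h (by positivity) (hQ z)

theorem norm_comp_orthProj_le {W : Type*} [SeminormedAddCommGroup W] [NormedSpace ℝ W]
    (h : OrthSystem (fun i => (y i : LpI p)) c A B K) (R : Y →L[ℝ] W) (ha : 0 ≤ a)
    (hR : ∀ i, ‖R (y i)‖ ≤ a * B) : ‖R ∘L orthProj h‖ ≤ Fintype.card ι * K * a := by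
  have := h.nonneg
  refine ContinuousLinearMap.opNorm_le_bound _ (by positivity) fun f => ?_
  rw [ContinuousLinearMap.comp_apply, orthProj_apply, map_sum, mul_assoc, mul_assoc,
    ← nsmul_eq_mul]
  refine norm_sum_le_of_le _ (fun i _ => ?_) |>.trans_eq (Finset.sum_const _)
  rw [map_smul, norm_smul, Real.norm_eq_abs, abs_div, abs_of_pos (h.pos i), div_mul_eq_mul_div,
    div_le_iff₀ (h.pos i)]
  calc |pairing f (y i)| * ‖R (y i)‖ ≤ A * ‖f‖ * (a * B) :=
        mul_le_mul (h.abs_pairing_le i f) (hR i) (norm_nonneg _)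
          ((abs_nonneg _).trans (h.abs_pairing_le i f))
    _ = a * ‖f‖ * (A * B) := by ring
    _ ≤ a * ‖f‖ * (K * c i) := mul_le_mul_of_nonneg_left (h.mul_le i) (by positivity)
    _ = K * (a * ‖f‖) * c i := by ring

theorem norm_orthProj_comp_sub_smul_id_le [DecidableEq ι]
    (h : OrthSystem (fun i => (y i : LpI p)) c A B K) (hY : Submodule.span ℝ (Set.range y) = ⊤)
    (R : Y →L[ℝ] LpI p) (r : ℝ) (ha : 0 ≤ a)
    (hR : ∀ i j, |pairing (R (y j)) (y i) - if i = j then r * c i else 0| ≤ a * (A * B)) :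
    ‖orthProj h ∘L R - r • ContinuousLinearMap.id ℝ Y‖ ≤
      Fintype.card ι * K * (Fintype.card ι * K * a) := by
  have hK := h.nonneg
  set D : Y →L[ℝ] Y := orthProj h ∘L R - r • ContinuousLinearMap.id ℝ Y
  have hD_eq : ∀ v, D v = orthProj h (R v + (-r) • (v : LpI p)) := fun v => by
    rw [map_add, map_smul, orthProj_coe h hY, neg_smul, ← sub_eq_add_neg]
    rfl
  have hpair : ∀ i j, pairing (R (y j) + (-r) • (y j : LpI p)) (y i) =
      pairing (R (y j)) (y i) - if i = j then r * c i else 0 := fun i j => by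
    rw [pairing_add_left (h.memLp_top i), pairing_smul_left]
    rcases eq_or_ne i j with rfl | hij
    · rw [if_pos rfl, h.pairing_self]
      ring
    · rw [if_neg hij, h.pairing_eq_zero hij.symm]
      ring
  have hD : ∀ j, ‖D (y j)‖ ≤ Fintype.card ι * K * a * B := fun j => by
    have hB : 0 ≤ B := (norm_nonneg (y j)).trans (h.norm_le j)
    rw [hD_eq, mul_assoc]
    refine norm_orthProj_apply_le h (by positivity) fun i => ?_
    rw [hpair, mul_assoc, mul_comm B]
    exact hR i j
  have hD_comp : D = (D ∘L orthProj h) ∘L Y.subtypeL := by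
    ext1 v
    exact congrArg D (orthProj_coe h hY v).symm
  rw [hD_comp]
  exact (norm_comp_subtypeL_le Y _).trans (norm_comp_orthProj_le h D (by positivity) hD)

theorem norm_orthProj_comp_le_of_eq_sum_smul {Z R : Type*} [SeminormedAddCommGroup Z]
    [NormedSpace ℝ Z] [Fintype R] (h : OrthSystem (fun i => (y i : LpI p)) c A B K)
    {Q : Z →L[ℝ] LpI p} {φ : R → Z →L[ℝ] ℝ} {f : R → LpI p} (hQ : ∀ z, Q z = ∑ q, φ q z • f q)
    {D : ℝ} (hD : 0 ≤ D) (hφ : ∀ q, ‖φ q‖ ≤ D) (ha : 0 ≤ a)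
    (hf : ∀ q i, |pairing (f q) (y i)| ≤ a * A) :
    ‖orthProj h ∘L Q‖ ≤ Fintype.card ι * K * (Fintype.card R * (D * a)) := by
  refine norm_orthProj_comp_le h Q (by positivity) fun z i => ?_
  rw [hQ, ← pairingCLM_apply (h.memLp_top i), map_sum]
  calc |∑ q, pairingCLM (y i : LpI p) (h.memLp_top i) (φ q z • f q)|
      ≤ ∑ _q : R, D * ‖z‖ * (a * A) := by
        refine (Finset.abs_sum_le_sum_abs _ _).trans (Finset.sum_le_sum fun q _ => ?_)
        rw [map_smul, pairingCLM_apply, smul_eq_mul, abs_mul]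
        exact mul_le_mul ((φ q).le_of_opNorm_le (hφ q) z) (hf q i) (abs_nonneg _) (by positivity)
    _ = Fintype.card R * (D * a) * ‖z‖ * A := by
        rw [Finset.sum_const, Finset.card_univ, nsmul_eq_mul]
        ring

theorem norm_comp_orthProj_le_of_eq_sum_smul {W R : Type*} [SeminormedAddCommGroup W]
    [NormedSpace ℝ W] [Fintype R] (h : OrthSystem (fun i => (y i : LpI p)) c A B K)
    {Q : Y →L[ℝ] W} {φ : R → Y → ℝ} {w : R → W} (hQ : ∀ v, Q v = ∑ q, φ q v • w q)
    (hw : ∀ q, ‖w q‖ ≤ 1) (ha : 0 ≤ a) (hφ : ∀ q i, |φ q (y i)| ≤ a * B) :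
    ‖Q ∘L orthProj h‖ ≤ Fintype.card ι * K * (Fintype.card R * a) := by
  refine norm_comp_orthProj_le h Q (by positivity) fun i => ?_
  rw [hQ, mul_assoc, ← nsmul_eq_mul]
  refine norm_sum_le_of_le _ (fun q _ => ?_) |>.trans_eq (Finset.sum_const _)
  rw [norm_smul]
  exact (mul_le_of_le_one_right (norm_nonneg _) (hw q)).trans (hφ q i)

end ProjectionBounds

section FiniteRank

variable {Z F : Type*} [SeminormedAddCommGroup Z] [NormedSpace ℝ Z] [NormedAddCommGroup F]
  [NormedSpace ℝ F]

theorem exists_range_sub_smulRight_lt {Q : Z →L[ℝ] F} (hQ : Q ≠ 0) :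
    ∃ (φ : Z →L[ℝ] ℝ) (f : F), ‖φ‖ ≤ ‖Q‖ ∧ ‖f‖ = 1 ∧
      (Q - φ.smulRight f).toLinearMap.range < Q.toLinearMap.range := by
  obtain ⟨z, hz⟩ : ∃ z, Q z ≠ 0 := by
    by_contra! h
    exact hQ (ContinuousLinearMap.ext h)
  have hnorm : ‖Q z‖ ≠ 0 := norm_ne_zero_iff.mpr hz
  obtain ⟨ψ, hψ, hψz⟩ := exists_dual_vector ℝ (Q z) hnorm
  set f : F := ‖Q z‖⁻¹ • Q z
  have hψf : ψ f = 1 := by simp [f, hψz, hnorm]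
  have hf : f ∈ Q.toLinearMap.range := Submodule.smul_mem _ _ ⟨z, rfl⟩
  refine ⟨ψ ∘L Q, f, ?_, by simp [f, norm_smul, hnorm], lt_of_le_of_ne ?_ fun heq => ?_⟩
  · simpa [hψ] using ψ.opNorm_comp_le Q
  · rintro _ ⟨x, rfl⟩
    exact Submodule.sub_mem _ ⟨x, rfl⟩ (Submodule.smul_mem _ _ hf)
  · -- `ψ` vanishes on the range of the difference, but not at `f`.
    obtain ⟨x, hx⟩ := heq ▸ hf
    have hx' : ψ (Q x - ψ (Q x) • f) = ψ f := congrArg ψ hx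
    simp [hψf] at hx'

theorem exists_eq_sum_smul_of_finrank_le (m : ℕ) (Q : Z →L[ℝ] F)
    [FiniteDimensional ℝ Q.toLinearMap.range] (h : Module.finrank ℝ Q.toLinearMap.range ≤ m) :
    ∃ (φ : Fin m → Z →L[ℝ] ℝ) (f : Fin m → F), (∀ z, Q z = ∑ j, φ j z • f j) ∧
      (∀ j, ‖φ j‖ ≤ 2 ^ m * ‖Q‖) ∧ ∀ j, ‖f j‖ ≤ 1 := by
  induction m generalizing Q with
  | zero =>
    have hrange : Q.toLinearMap.range = ⊥ :=
      Submodule.finrank_eq_zero.mp (Nat.le_zero.mp h)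
    refine ⟨Fin.elim0, Fin.elim0, fun z => ?_, fun j => j.elim0, fun j => j.elim0⟩
    simpa using LinearMap.congr_fun (LinearMap.range_eq_bot.mp hrange) z
  | succ m ih =>
    rcases eq_or_ne Q 0 with rfl | hQ
    · exact ⟨0, 0, by simp, by simp, by simp⟩
    obtain ⟨ψ, g, hψ, hg, hlt⟩ := exists_range_sub_smulRight_lt hQ
    set Q' : Z →L[ℝ] F := Q - ψ.smulRight g
    have : FiniteDimensional ℝ Q'.toLinearMap.range := Submodule.finiteDimensional_of_le hlt.le
    have hrank := Submodule.finrank_lt_finrank_of_lt hlt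
    obtain ⟨φ, f, hsum, hφ, hf⟩ := ih Q' (by omega)
    have hQ' : ‖Q'‖ ≤ 2 * ‖Q‖ := by
      refine (norm_sub_le _ _).trans ?_
      rw [ContinuousLinearMap.norm_smulRight_apply, hg, mul_one]
      linarith
    refine ⟨Fin.cons ψ φ, Fin.cons g f, fun z => ?_, Fin.cases ?_ fun j => ?_,
      Fin.cases hg.le hf⟩
    · rw [Fin.sum_univ_succ]
      simp only [Fin.cons_zero, Fin.cons_succ]
      rw [← hsum z]
      exact (add_sub_cancel (ψ z • g) (Q z)).symm
    · exact hψ.trans (le_mul_of_one_le_left (norm_nonneg Q) (one_le_pow₀ one_le_two))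
    · calc ‖φ j‖ ≤ 2 ^ m * ‖Q'‖ := hφ j
        _ ≤ 2 ^ m * (2 * ‖Q‖) := by gcongr
        _ = 2 ^ (m + 1) * ‖Q‖ := by ring

theorem exists_eq_sum_smul_of_rank_le {m : ℕ} {Q : Z →L[ℝ] F}
    (h : Q.toLinearMap.rank ≤ m) :
    ∃ (φ : Fin m → Z →L[ℝ] ℝ) (f : Fin m → F), (∀ z, Q z = ∑ j, φ j z • f j) ∧
      (∀ j, ‖φ j‖ ≤ 2 ^ m * ‖Q‖) ∧ ∀ j, ‖f j‖ ≤ 1 :=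
  have : FiniteDimensional ℝ Q.toLinearMap.range :=
    Module.rank_lt_aleph0_iff.mp (h.trans_lt Cardinal.natCast_lt_aleph0)
  exists_eq_sum_smul_of_finrank_le m Q (Module.finrank_le_of_rank_le h)

end FiniteRank

section Levels

theorem exists_finset_pairwise_abs_sub_le (n : ℕ) (C : ℝ) {δ : ℝ} (hδ : 0 < δ) :
    ∃ L : ℕ, ∀ s : Finset ℕ, L ≤ s.card → ∀ d : ℕ → ℝ, (∀ i ∈ s, |d i| ≤ C) →
      ∃ A ⊆ s, A.card = n ∧ ∀ i ∈ A, ∀ j ∈ A, |d i - d j| ≤ δ := by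
  set b : ℕ := ⌊2 * C / δ⌋₊ + 1 with hb
  refine ⟨b * n, fun s hs d hd => ?_⟩
  have hnonneg : ∀ i ∈ s, 0 ≤ (d i + C) / δ := fun i hi =>
    div_nonneg (neg_le_iff_add_nonneg.mp (abs_le.mp (hd i hi)).1) hδ.le
  have hmaps : ∀ i ∈ s, ⌊(d i + C) / δ⌋₊ ∈ Finset.range b := fun i hi => by
    have := (abs_le.mp (hd i hi)).2
    rw [Finset.mem_range, hb, Nat.lt_succ_iff]
    gcongr
    linarith
  obtain ⟨q, -, hq⟩ := Finset.exists_le_card_fiber_of_mul_le_card_of_maps_to hmaps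
    (n := n) ⟨0, by simp [hb]⟩ (by simpa using hs)
  obtain ⟨A, hA, hcard⟩ := Finset.exists_subset_card_eq hq
  refine ⟨A, hA.trans (Finset.filter_subset _ _), hcard, fun i hi j hj => ?_⟩
  have hcell : ∀ i ∈ A, q * δ ≤ d i + C ∧ d i + C < (q + 1) * δ := fun i hi => by
    obtain ⟨his, hfloor⟩ := Finset.mem_filter.mp (hA hi)
    rwa [Nat.floor_eq_iff (hnonneg i his), le_div_iff₀ hδ, div_lt_iff₀ hδ] at hfloor
  rw [abs_le]
  constructor <;> linarith [(hcell i hi).1, (hcell i hi).2, (hcell j hj).1, (hcell j hj).2]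

theorem exists_strictMono_mem {n : ℕ} {A : Finset ℕ} (hA : A.card = n) :
    ∃ g : ℕ → ℕ, StrictMono g ∧ ∀ s < n, g s ∈ A := by
  set o := A.orderEmbOfFin hA
  have ho : ∀ s, o s ∈ A := A.orderEmbOfFin_mem hA
  refine ⟨fun s => if h : s < n then o ⟨s, h⟩ else A.sup id + 1 + s,
    strictMono_nat_of_lt_succ fun s => ?_, fun s hs => by simpa [hs] using ho ⟨s, hs⟩⟩
  have hsup : ∀ t, o t ≤ A.sup id := fun t => Finset.le_sup (f := id) (ho t)
  rcases lt_or_ge (s + 1) n with hs | hs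
  · simp [hs, Nat.lt_of_succ_lt hs]
  · rw [dif_neg hs.not_gt]
    split_ifs with hs'
    · have := hsup ⟨s, hs'⟩
      omega
    · omega

theorem exists_nearly_constant_levels (n : ℕ) (C : ℝ) {δ : ℝ} (hδ : 0 < δ) :
    ∃ L : ℕ, ∀ M k : ℕ, M + L ≤ k → ∀ d : ℕ → ℝ, (∀ i < k, |d i| ≤ C) →
      ∃ g : ℕ → ℕ, StrictMono g ∧ (∀ s < n, M ≤ g s) ∧ (∀ s < n, g s < k) ∧
        ∀ s < n, ∀ t < n, |d (g s) - d (g t)| ≤ δ := by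
  obtain ⟨L, hL⟩ := exists_finset_pairwise_abs_sub_le n C hδ
  refine ⟨L, fun M k hk d hd => ?_⟩
  obtain ⟨A, hA, hcard, hclose⟩ := hL (Finset.Ico M k) (by rw [Nat.card_Ico]; omega) d
    fun i hi => hd i (Finset.mem_Ico.mp hi).2
  obtain ⟨g, hg, hgA⟩ := exists_strictMono_mem hcard
  have hmem : ∀ s < n, M ≤ g s ∧ g s < k := fun s hs => Finset.mem_Ico.mp (hA (hgA s hs))
  exact ⟨g, hg, fun s hs => (hmem s hs).1, fun s hs => (hmem s hs).2,
    fun s hs t ht => hclose _ (hgA s hs) _ (hgA t ht)⟩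

end Levels

section JointForm

variable {p : ℝ≥0∞} {k N : ℕ} {X : Submodule ℝ (LpI p)} {S : Fin N → (LpHaar p k →ₗ[ℝ] X)}
  {θ : Fin N → ℝ}

theorem memLp_top_joint (hS : ∀ l, IsCompression (θ l) (S l)) (F : Fin N → LpHaar p k) :
    MemLp (joint S F : LpI p) ∞ leb01 := by
  have hsum : MemLp (fun x => ∑ l, (S l (F l) : LpI p) x) ∞ leb01 :=
    memLp_finsetSum Finset.univ fun l _ => (hS l).memLp_top (memLp_top_of_mem_LpHaar (F l).2)
  exact hsum.ae_eq (coeFn_joint S F).symm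

theorem joint_haarFamily (i : Fin k) (l : Fin N) (j : Fin (2 ^ (i : ℕ))) :
    joint S (haarFamily p k i (l, (j : ℕ))) = S l (haarIn p k i j) := by
  have hmem : haarMem p k i j = haarIn p k i j := Subtype.ext (coe_haarMem i.2 j.2)
  rw [joint_apply, haarFamily, Fintype.sum_eq_single l fun l' hl => by
    rw [Pi.single_eq_of_ne hl, map_zero], Pi.single_eq_same, hmem]

variable [Fact (1 ≤ p)]

/-- The bilinear map `(f, F) ↦ ⟨f, ∑_l S_l F_l⟩`. -/
noncomputable def jointPairing (hS : ∀ l, IsCompression (θ l) (S l)) :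
    LpI p →ₗ[ℝ] (Fin N → LpHaar p k) →ₗ[ℝ] ℝ :=
  LinearMap.mk₂ ℝ (fun f F => pairing f (joint S F))
    (fun f f' F => pairing_add_left (memLp_top_joint hS F) f f')
    (fun c f F => pairing_smul_left c f _)
    (fun f F F' => by
      rw [map_add, Submodule.coe_add,
        pairing_add_right (memLp_top_joint hS F) (memLp_top_joint hS F')])
    (fun c f F => by rw [map_smul, Submodule.coe_smul, pairing_smul_right, smul_eq_mul])

theorem jointPairing_apply (hS : ∀ l, IsCompression (θ l) (S l)) (f : LpI p)
    (F : Fin N → LpHaar p k) : jointPairing hS f F = pairing f (joint S F) := rfl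

/-- The bilinear form `(F, G) ↦ ⟨T ∑_l S_l F_l, ∑_l S_l G_l⟩`. -/
noncomputable def jointForm (hS : ∀ l, IsCompression (θ l) (S l)) (T : X →L[ℝ] LpI p) :
    (Fin N → LpHaar p k) →ₗ[ℝ] (Fin N → LpHaar p k) →ₗ[ℝ] ℝ :=
  jointPairing hS ∘ₗ (T : X →ₗ[ℝ] LpI p) ∘ₗ joint S

theorem jointForm_apply (hS : ∀ l, IsCompression (θ l) (S l)) (T : X →L[ℝ] LpI p)
    (F : Fin N → LpHaar p k) : jointForm hS T F = jointPairing hS (T (joint S F)) := rfl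

theorem diagAverage_eq_diagSum (hS : ∀ l, IsCompression (θ l) (S l)) (T : X →L[ℝ] LpI p) (Θ : ℝ)
    (i : Fin k) : diagAverage T S Θ i = diagSum (haarFamily p k) (Θ⁻¹ • jointForm hS T) i := by
  rw [diagAverage, diagSum, treeLevel, Finset.sum_product, Finset.mul_sum]
  refine Finset.sum_congr rfl fun l _ => ?_
  rw [Finset.sum_range, Finset.mul_sum]
  refine Finset.sum_congr rfl fun j _ => ?_
  rw [LinearMap.smul_apply, LinearMap.smul_apply, jointForm_apply, jointPairing_apply,
    joint_haarFamily, pairing_comm, smul_eq_mul]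

variable {w : Fin N → ℝ} {Θ C : ℝ} {hS : ∀ l, IsCompression (Θ * w l) (S l)}

theorem functionalBound_jointPairing (hd : DisjointRanges S) (hΘ : 0 ≤ Θ) (hw : ∀ l, 0 ≤ w l)
    {f : LpI p} (hf : ‖f‖ ≤ C) :
    FunctionalBound k w (haarFamily p k) (jointPairing hS f) (C * Θ ^ (1 - p.toReal⁻¹))
      (1 - p.toReal⁻¹) := by
  intro i hi B hB ξ hξ
  have hbound := (unitSupported_joint_sum hd hS hi hB hξ).abs_pairing_le f
  have hB0 := nodeWeight_nonneg hw i B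
  rw [nodeWeight_const_mul, Real.mul_rpow hΘ hB0, mul_comm] at hbound
  rw [jointPairing_apply, mul_assoc]
  exact hbound.trans (by gcongr)

theorem functionalBound_comp_joint (hS : ∀ l, IsCompression (Θ * w l) (S l))
    (hd : DisjointRanges S) (hΘ : 0 ≤ Θ) (hw : ∀ l, 0 ≤ w l) {φ : X →L[ℝ] ℝ} (hφ : ‖φ‖ ≤ C) :
    FunctionalBound k w (haarFamily p k) ((φ : X →ₗ[ℝ] ℝ) ∘ₗ joint S) (C * Θ ^ p.toReal⁻¹)
      p.toReal⁻¹ := by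
  intro i hi B hB ξ hξ
  have hnorm := (unitSupported_joint_sum hd hS hi hB hξ).norm_le
  rw [nodeWeight_const_mul, Real.mul_rpow hΘ (nodeWeight_nonneg hw i B)] at hnorm
  rw [mul_assoc]
  exact φ.le_of_opNorm_le_of_le hφ hnorm

theorem formBound_jointForm (hd : DisjointRanges S) (hΘ : 0 < Θ) (hw : ∀ l, 0 ≤ w l)
    {T : X →L[ℝ] LpI p} (hT : ‖T‖ ≤ C) :
    FormBound k w (haarFamily p k) (jointForm hS T) (C * Θ) p.toReal⁻¹ (1 - p.toReal⁻¹) := by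
  intro i hi B hB ξ hξ
  have hnorm := (unitSupported_joint_sum hd hS hi hB hξ).norm_le
  rw [nodeWeight_const_mul, Real.mul_rpow hΘ.le (nodeWeight_nonneg hw i B)] at hnorm
  have hΘ_rpow : Θ ^ p.toReal⁻¹ * Θ ^ (1 - p.toReal⁻¹) = Θ := by
    rw [← Real.rpow_add hΘ, add_sub_cancel, Real.rpow_one]
  have hbound : C * Θ * nodeWeight w i B ^ p.toReal⁻¹ =
      C * (Θ ^ p.toReal⁻¹ * nodeWeight w i B ^ p.toReal⁻¹) * Θ ^ (1 - p.toReal⁻¹) := by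
    linear_combination -(C * nodeWeight w i B ^ p.toReal⁻¹) * hΘ_rpow
  rw [jointForm_apply, hbound]
  exact functionalBound_jointPairing hd hΘ.le hw (T.le_of_opNorm_le_of_le hT hnorm)

end JointForm

section AlmostDiagonal

variable {ι V R : Type*} [Fintype ι] [DecidableEq ι] [AddCommGroup V] [Module ℝ V]

theorem BalancedLevel.abs_form_sub_ite_le {n : ℕ} {g : ℕ → ℕ} {e : ℕ → ι × ℕ → V}
    {β : V →ₗ[ℝ] V →ₗ[ℝ] ℝ} {Λ : R → V →ₗ[ℝ] ℝ} {σ : ℕ → ι × ℕ → ℤˣ} {δ r : ℝ}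
    (hg : StrictMono g) (h : ∀ t < n, BalancedLevel n g e β Λ δ t σ)
    (hr : ∀ t < n, |diagSum e β (g t) - r| ≤ δ) (a b : HaarIndex n) :
    |β (blockVec g σ e b.1 b.2) (blockVec g σ e a.1 a.2) -
      if a = b then r * (1 / 2) ^ (a.1 : ℕ) else 0| ≤ (n + 1) * δ := by
  obtain ⟨t, j⟩ := a
  have hδ : 0 ≤ δ := (abs_nonneg _).trans (hr t t.2)
  have htn : (t : ℝ) + 1 ≤ n := mod_cast t.2
  split_ifs with hab
  · subst hab
    have hpow : (1 / 2 : ℝ) ^ (t : ℕ) ≤ 1 := pow_le_one₀ (by norm_num) (by norm_num)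
    have htrace : |diagSum e β (g t) / 2 ^ (t : ℕ) - r * (1 / 2) ^ (t : ℕ)| ≤ δ := by
      rw [one_div, inv_pow, ← div_eq_mul_inv, ← sub_div, div_eq_mul_inv, abs_mul, ← inv_pow,
        ← one_div, abs_of_nonneg (by positivity : (0 : ℝ) ≤ (1 / 2) ^ (t : ℕ))]
      exact (mul_le_of_le_one_right (abs_nonneg _) hpow).trans (hr t t.2)
    calc _ ≤ _ := abs_sub_le _ _ _
      _ ≤ (t + 1) * δ + δ := add_le_add (abs_form_self_sub_le hg h t.2 j.2) htrace
      _ = (t + 1 + 1) * δ := by ring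
      _ ≤ (n + 1) * δ := by gcongr
  · rw [sub_zero]
    refine (abs_form_le h b.1.2 t.2 b.2.2 j.2 fun hne => hab ?_).trans
      (le_mul_of_one_le_left hδ (by simp))
    obtain ⟨t', j'⟩ := b
    simp only [Prod.mk.injEq] at hne
    obtain rfl : t = t' := Fin.ext hne.1.symm
    rw [Fin.ext hne.2]

end AlmostDiagonal

section Selection

variable {R : Type*} [Finite R]

theorem exists_almost_diagonal_blockVec {n : ℕ} (hn : 0 < n) (C : ℝ) {x y κ δ : ℝ} (hκ : 0 < κ)
    (hx : κ ≤ x) (hy : κ ≤ y) (hxy : x + y = 1) (hδ : 0 < δ) :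
    ∃ k₀, ∀ k ≥ k₀, ∀ {ι V : Type*} [Fintype ι] [AddCommGroup V] [Module ℝ V]
      {w : ι → ℝ} {e : ℕ → ι × ℕ → V} {β : V →ₗ[ℝ] V →ₗ[ℝ] ℝ} {Λ : R → V →ₗ[ℝ] ℝ},
      w ∈ stdSimplex ℝ ι → FormBound k w e β C x y → (∀ r, FunctionalBound k w e (Λ r) C κ) →
      ∃ (g : ℕ → ℕ) (σ : ℕ → ι × ℕ → ℤˣ), StrictMono g ∧ (∀ s < n, g s < k) ∧
        (∀ (a : HaarIndex n) r, |Λ r (blockVec g σ e a.1 a.2)| ≤ δ) ∧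
        ∀ a b : HaarIndex n, |β (blockVec g σ e b.1 b.2) (blockVec g σ e a.1 a.2) -
          if a = b then diagSum e β (g 0) * (1 / 2) ^ (a.1 : ℕ) else 0| ≤ δ := by
  classical
  cases nonempty_fintype R
  set η : ℝ := δ / (n + 1) with hη
  have hη0 : 0 < η := by positivity
  have hηδ : (n + 1) * η = δ := by rw [hη]; field_simp
  have hη_le : η ≤ δ := hηδ ▸ le_mul_of_one_le_left hη0.le (by simp)
  obtain ⟨M, hM⟩ := exists_small_level (balanceCount (Fintype.card R) n) C hκ hη0
  obtain ⟨L, hL⟩ := exists_nearly_constant_levels n C hη0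
  refine ⟨M + L, fun k hk ι V _ _ _ w e β Λ hw hβ hΛ => ?_⟩
  have hdiag : ∀ i < k, |diagSum e β i| ≤ C := fun i hi => by
    have hsum := hβ.sum_abs_diag_le hw.1 (hκ.le.trans hx) (hκ.le.trans hy) hxy hi subset_rfl
    rw [nodeWeight_treeLevel, hw.2, mul_one] at hsum
    exact (Finset.abs_sum_le_sum_abs _ _).trans hsum
  obtain ⟨g, hg, hgM, hgk, hclose⟩ := hL M k hk _ hdiag
  have hC : 0 ≤ C := (abs_nonneg _).trans (hdiag _ (hgk 0 hn))
  obtain ⟨σ, hσ⟩ := exists_balanced_signs hg hgk hw hC hκ.le hx hy hxy hβ hΛ hη0.le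
    fun s hs => hM _ (hgM s hs)
  refine ⟨g, σ, hg, hgk, fun a r => ((hσ _ a.1.2).functional _ a.2.2 r).trans hη_le, fun a b => ?_⟩
  rw [← hηδ]
  exact BalancedLevel.abs_form_sub_ite_le hg hσ (fun t ht => hclose t ht 0 hn) a b

end Selection

section AlmostDiagonalEmbedding

variable {p : ℝ≥0∞} {n : ℕ} {X : Submodule ℝ (LpI p)} {R R' : Type*}

theorem assembled_haarIn {k N : ℕ} {S : Fin N → (LpHaar p k →ₗ[ℝ] X)}
    {J : Fin N → (LpHaar p n →ₗ[ℝ] LpHaar p k)} {v : ℕ → ℕ → Fin N → LpHaar p k}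
    (hJ : ∀ l, ∀ t < n, ∀ j < 2 ^ t, J l (haarMem p n t j) = v t j l) (a : HaarIndex n) :
    assembled S J (haarIn p n a.1 a.2) = joint S (v a.1 a.2) := by
  have hmem : haarIn p n a.1 a.2 = haarMem p n a.1 a.2 :=
    Subtype.ext (coe_haarMem a.1.2 a.2.2).symm
  rw [assembled_apply, hmem]
  exact congrArg (joint S) (funext fun l => hJ l a.1 a.1.2 a.2 a.2.2)

variable [Fact (1 ≤ p)]

/-- The functions `S h_I` are, up to errors of size `δ` relative to their norms, orthogonal to the
`T S h_J` with `J ≠ I`, annihilated by the functionals `⟨f q, ·⟩` and `φ q`, and satisfy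
`⟨T S h_I, S h_I⟩ = r |supp S h_I|`, where `S` is a `θ`-compression. -/
structure AlmostDiagonal (T : X →L[ℝ] LpI p) (f : R → LpI p) (φ : R' → X →L[ℝ] ℝ)
    (S : LpHaar p n →ₗ[ℝ] X) (θ r δ : ℝ) : Prop where
  abs_form_sub_le : ∀ a b : HaarIndex n,
    |pairing (T (S (haarIn p n b.1 b.2))) (S (haarIn p n a.1 a.2)) -
      if a = b then r * (θ * (1 / 2) ^ (a.1 : ℕ)) else 0| ≤ δ * θ
  abs_pairing_le : ∀ q (a : HaarIndex n),
    |pairing (f q) (S (haarIn p n a.1 a.2))| ≤ δ * θ ^ (1 - p.toReal⁻¹)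
  abs_functional_le : ∀ q (a : HaarIndex n), |φ q (S (haarIn p n a.1 a.2))| ≤ δ * θ ^ p.toReal⁻¹

/-- The functionals `⟨f r, ∑_l S_l F_l⟩` and `φ r (∑_l S_l F_l)` of `F`, divided by the powers of
`Θ` that make their bounds on unions of blocks independent of `Θ`. -/
noncomputable def normalizedFunctional {k N : ℕ} {S : Fin N → (LpHaar p k →ₗ[ℝ] X)} {θ : Fin N → ℝ}
    (hS : ∀ l, IsCompression (θ l) (S l)) (f : R → LpI p) (φ : R' → X →L[ℝ] ℝ) (Θ : ℝ) :
    R ⊕ R' → (Fin N → LpHaar p k) →ₗ[ℝ] ℝ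
  | .inl r => (Θ ^ (1 - p.toReal⁻¹))⁻¹ • jointPairing hS (f r)
  | .inr r => (Θ ^ p.toReal⁻¹)⁻¹ • ((φ r : X →ₗ[ℝ] ℝ) ∘ₗ joint S)

theorem functionalBound_normalizedFunctional {k N : ℕ} {S : Fin N → (LpHaar p k →ₗ[ℝ] X)}
    (hd : DisjointRanges S) {w : Fin N → ℝ} (hw : w ∈ stdSimplex ℝ (Fin N)) {Θ : ℝ} (hΘ : 0 < Θ)
    (hS : ∀ l, IsCompression (Θ * w l) (S l)) {f : R → LpI p} {φ : R' → X →L[ℝ] ℝ} {C κ : ℝ}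
    (hC : 0 ≤ C) (hf : ∀ r, ‖f r‖ ≤ C) (hφ : ∀ r, ‖φ r‖ ≤ C) (hκ : 0 ≤ κ) (hκx : κ ≤ p.toReal⁻¹)
    (hκy : κ ≤ 1 - p.toReal⁻¹) (q : R ⊕ R') :
    FunctionalBound k w (haarFamily p k) (normalizedFunctional hS f φ Θ q) C κ := by
  rcases q with r | r
  · exact (functionalBound_jointPairing hd hΘ.le hw.1 (hf r)).inv_smul
      (Real.rpow_pos_of_pos hΘ _) |>.mono hw le_rfl hC hκ hκy
  · exact (functionalBound_comp_joint hS hd hΘ.le hw.1 (hφ r)).inv_smul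
      (Real.rpow_pos_of_pos hΘ _) |>.mono hw le_rfl hC hκ hκx

theorem almostDiagonal_assembled {k N : ℕ} {S : Fin N → (LpHaar p k →ₗ[ℝ] X)} {θ : Fin N → ℝ}
    (hS : ∀ l, IsCompression (θ l) (S l)) {T : X →L[ℝ] LpI p} {f : R → LpI p}
    {φ : R' → X →L[ℝ] ℝ} {Θ r δ : ℝ} (hΘ : 0 < Θ) {J : Fin N → (LpHaar p n →ₗ[ℝ] LpHaar p k)}
    {v : ℕ → ℕ → Fin N → LpHaar p k}
    (hJ : ∀ l, ∀ t < n, ∀ j < 2 ^ t, J l (haarMem p n t j) = v t j l)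
    (hfunctional : ∀ (a : HaarIndex n) q, |normalizedFunctional hS f φ Θ q (v a.1 a.2)| ≤ δ)
    (hform : ∀ a b : HaarIndex n, |(Θ⁻¹ • jointForm hS T) (v b.1 b.2) (v a.1 a.2) -
      if a = b then r * (1 / 2) ^ (a.1 : ℕ) else 0| ≤ δ) :
    AlmostDiagonal T f φ (assembled S J) Θ r δ := by
  have hscale : ∀ {c : ℝ}, 0 < c → ∀ {x : ℝ}, |c⁻¹ * x| ≤ δ → |x| ≤ δ * c := fun hc x hx => by
    rwa [abs_mul, abs_of_pos (inv_pos.mpr hc), inv_mul_le_iff₀' hc] at hx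
  refine ⟨fun a b => hscale hΘ ?_, fun r a => hscale (Real.rpow_pos_of_pos hΘ _) ?_,
    fun r a => hscale (Real.rpow_pos_of_pos hΘ _) ?_⟩
  · rw [assembled_haarIn hJ, assembled_haarIn hJ, mul_sub, mul_ite, mul_zero, mul_left_comm r,
      inv_mul_cancel_left₀ hΘ.ne']
    exact hform a b
  · rw [assembled_haarIn hJ]
    exact hfunctional a (.inl r)
  · rw [assembled_haarIn hJ]
    exact hfunctional a (.inr r)

theorem exists_almostDiagonal_assembled [Finite R] [Finite R'] (hp1 : 1 < p) (hp : p ≠ ∞)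
    (hn : 0 < n) (C : ℝ) {δ : ℝ} (hδ : 0 < δ) :
    ∃ k₀, ∀ k ≥ k₀, ∀ {X : Submodule ℝ (LpI p)} {T : X →L[ℝ] LpI p} {f : R → LpI p}
      {φ : R' → X →L[ℝ] ℝ}, ‖T‖ ≤ C → (∀ r, ‖f r‖ ≤ C) → (∀ r, ‖φ r‖ ≤ C) →
      ∀ {N : ℕ} {S : Fin N → (LpHaar p k →ₗ[ℝ] X)} {θ : Fin N → ℝ},
      (∀ l, IsCompression (θ l) (S l)) → DisjointRanges S → 0 < ∑ l, θ l →
      ∃ J : Fin N → (LpHaar p n →ₗ[ℝ] LpHaar p k), (∀ l, IsDistEmbedding (J l)) ∧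
        ∃ i : Fin k, AlmostDiagonal T f φ (assembled S J) (∑ l, θ l)
          (diagAverage T S (∑ l, θ l) i) δ := by
  have hx : 0 < p.toReal⁻¹ := inv_pos.mpr (ENNReal.toReal_pos (zero_lt_one.trans hp1).ne' hp)
  have hy : 0 < 1 - p.toReal⁻¹ := by
    rw [sub_pos]
    exact inv_lt_one_of_one_lt₀ (by simpa using (ENNReal.toReal_lt_toReal (by simp) hp).mpr hp1)
  set κ : ℝ := min p.toReal⁻¹ (1 - p.toReal⁻¹)
  have hκ : 0 < κ := lt_min hx hy
  have hκx : κ ≤ p.toReal⁻¹ := min_le_left _ _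
  have hκy : κ ≤ 1 - p.toReal⁻¹ := min_le_right _ _
  obtain ⟨k₀, hk₀⟩ := exists_almost_diagonal_blockVec (R := R ⊕ R') hn C hκ hκx hκy
    (add_sub_cancel _ _) hδ
  refine ⟨k₀, fun k hk X T f φ hT hf hφ N S θ hS hd hΘ => ?_⟩
  set Θ := ∑ l, θ l
  have hw : (fun l => θ l / Θ) ∈ stdSimplex ℝ (Fin N) :=
    ⟨fun l => div_nonneg (hS l).1.le hΘ.le, by rw [← Finset.sum_div, div_self hΘ.ne']⟩
  have hS' : ∀ l, IsCompression (Θ * (θ l / Θ)) (S l) := fun l => by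
    rw [mul_div_cancel₀ _ hΘ.ne']
    exact hS l
  have hC : 0 ≤ C := (ContinuousLinearMap.opNorm_nonneg T).trans hT
  obtain ⟨g, σ, hg, hgk, hfunctional, hform⟩ := hk₀ k hk hw
    ((formBound_jointForm (hS := hS') hd hΘ hw.1 hT).inv_smul hΘ)
    (functionalBound_normalizedFunctional hd hw hΘ hS' hC hf hφ hκ.le hκx hκy)
  choose J hJ hJ_haar using exists_distEmbedding (p := p) hg hgk σ
  refine ⟨J, hJ, ⟨g 0, hgk 0 hn⟩, ?_⟩
  rw [diagAverage_eq_diagSum hS']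
  exact almostDiagonal_assembled hS' hΘ hJ_haar hfunctional hform

end AlmostDiagonalEmbedding

section RangeHaar

variable {p : ℝ≥0∞} {n : ℕ} {X : Submodule ℝ (LpI p)}

/-- The functions `S h_I`, as members of the range of `S`. -/
noncomputable def rangeHaar (S : LpHaar p n →ₗ[ℝ] X) (a : HaarIndex n) : rangeLp S :=
  ⟨S (haarIn p n a.1 a.2), LinearMap.mem_range_self (X.subtype ∘ₗ S) _⟩

theorem span_range_haarIn :
    Submodule.span ℝ (Set.range fun a : HaarIndex n => haarIn p n a.1 a.2) = ⊤ := by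
  refine eq_top_iff.mpr fun ⟨f, hf⟩ _ => ?_
  induction hf using Submodule.span_induction with
  | mem f hf =>
    obtain ⟨i, j, hi, hj, rfl⟩ := hf
    exact Submodule.subset_span ⟨⟨⟨i, hi⟩, ⟨j, hj⟩⟩, rfl⟩
  | zero => exact Submodule.zero_mem _
  | add f g _ _ hf hg => exact Submodule.add_mem _ (hf trivial) (hg trivial)
  | smul c f _ hf => exact Submodule.smul_mem _ c (hf trivial)

theorem span_range_rangeHaar (S : LpHaar p n →ₗ[ℝ] X) :
    Submodule.span ℝ (Set.range (rangeHaar S)) = ⊤ := by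
  have himage : Set.range (rangeHaar S) = (X.subtype ∘ₗ S).rangeRestrict ''
      Set.range fun a : HaarIndex n => haarIn p n a.1 a.2 :=
    Set.range_comp (X.subtype ∘ₗ S).rangeRestrict _
  have hspan := Submodule.map_span (X.subtype ∘ₗ S).rangeRestrict
    (Set.range fun a : HaarIndex n => haarIn p n a.1 a.2)
  rw [span_range_haarIn, Submodule.map_top, LinearMap.range_rangeRestrict] at hspan
  rw [himage]
  exact hspan.symm

variable [Fact (1 ≤ p)] {θ r δ : ℝ} {S : LpHaar p n →ₗ[ℝ] X}

theorem IsCompression.orthSystem_rangeHaar (hS : IsCompression θ S) :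
    OrthSystem (fun a : HaarIndex n => (rangeHaar S a : LpI p))
      (fun a => θ * (1 / 2) ^ (a.1 : ℕ)) (θ ^ (1 - p.toReal⁻¹)) (θ ^ p.toReal⁻¹) (2 ^ n) := by
  have hbounded : ∀ a : HaarIndex n, MemLp (haarIn p n a.1 a.2 : LpI p) ∞ leb01 := fun a =>
    memLp_top_of_mem_LpHaar (haarIn p n a.1 a.2).2
  have hunit : ∀ a : HaarIndex n, UnitSupported (rangeHaar S a : LpI p) θ := fun a => by
    have := hS.unitSupported (f := haarIn p n a.1 a.2) (unitSupported_haar a.1 a.2)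
    rwa [mul_one] at this
  have hpair : ∀ a b : HaarIndex n, pairing (rangeHaar S a : LpI p) (rangeHaar S b) =
      θ * pairing (haar p a.1 a.2) (haar p b.1 b.2) := fun a b =>
    hS.pairing_eq (hbounded a) (hbounded b)
  refine ⟨fun a => mul_pos hS.1 (by positivity), fun a => hS.memLp_top (hbounded a), fun a => ?_,
    fun a b hab => ?_, fun a => (hunit a).abs_pairing_le, fun a => (hunit a).norm_le,
    by positivity, fun a => ?_⟩
  · rw [hpair, pairing_haar_self a.2.2]
  · have hne : ((a.1 : ℕ), (a.2 : ℕ)) ≠ ((b.1 : ℕ), (b.2 : ℕ)) := fun h =>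
      have ⟨hlevel, hposition⟩ := Prod.ext_iff.mp h
      hab (Sigma.ext (Fin.ext hlevel) ((Fin.heq_ext_iff (congrArg (2 ^ ·) hlevel)).mpr hposition))
    exact (hpair a b).trans (by rw [pairing_haar_of_ne a.2.2 b.2.2 hne, mul_zero])
  · rw [← Real.rpow_add hS.1, sub_add_cancel, Real.rpow_one, mul_left_comm, one_div, inv_pow,
      ← div_eq_mul_inv]
    exact le_mul_of_one_le_right hS.1.le ((one_le_div (by positivity)).mpr
      (pow_le_pow_right₀ one_le_two a.1.2.le))

theorem card_haarIndex_mul_le (n : ℕ) : (Fintype.card (HaarIndex n) : ℝ) * 2 ^ n ≤ 4 ^ n := by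
  rw [show (4 : ℝ) = 2 * 2 by norm_num, mul_pow]
  exact mul_le_mul_of_nonneg_right (mod_cast card_haarIndex_le le_rfl) (by positivity)

namespace AlmostDiagonal

variable {R R' : Type*} {T : X →L[ℝ] LpI p} {f : R → LpI p} {φ : R' → X →L[ℝ] ℝ}

theorem norm_orthProj_comp_sub_smul_id_le (h : AlmostDiagonal T f φ S θ r δ)
    (hS : IsCompression θ S) (hδ : 0 ≤ δ) :
    ‖orthProj hS.orthSystem_rangeHaar ∘L T ∘L rangeIncl S -
      r • ContinuousLinearMap.id ℝ (rangeLp S)‖ ≤ 4 ^ n * (4 ^ n * δ) := by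
  have hθ : θ ^ (1 - p.toReal⁻¹) * θ ^ p.toReal⁻¹ = θ := by
    rw [← Real.rpow_add hS.1, sub_add_cancel, Real.rpow_one]
  refine (_root_.norm_orthProj_comp_sub_smul_id_le hS.orthSystem_rangeHaar
    (span_range_rangeHaar S) (T ∘L rangeIncl S) r hδ fun a b => ?_).trans ?_
  · rw [hθ]
    exact h.abs_form_sub_le a b
  · gcongr <;> exact card_haarIndex_mul_le n

theorem norm_orthProj_comp_le [Fintype R] (h : AlmostDiagonal T f φ S θ r δ)
    (hS : IsCompression θ S) (hδ : 0 ≤ δ) {Z : Type*} [SeminormedAddCommGroup Z] [NormedSpace ℝ Z]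
    {Q : Z →L[ℝ] LpI p} {ψ : R → Z →L[ℝ] ℝ} (hQ : ∀ z, Q z = ∑ q, ψ q z • f q) {D : ℝ}
    (hD : 0 ≤ D) (hψ : ∀ q, ‖ψ q‖ ≤ D) :
    ‖orthProj hS.orthSystem_rangeHaar ∘L Q‖ ≤ 4 ^ n * (Fintype.card R * (D * δ)) := by
  refine (norm_orthProj_comp_le_of_eq_sum_smul hS.orthSystem_rangeHaar hQ hD hψ hδ
    h.abs_pairing_le).trans ?_
  gcongr
  exact card_haarIndex_mul_le n

theorem norm_comp_orthProj_le [Fintype R'] (h : AlmostDiagonal T f φ S θ r δ)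
    (hS : IsCompression θ S) (hδ : 0 ≤ δ) {W : Type*} [SeminormedAddCommGroup W] [NormedSpace ℝ W]
    {Q : X →L[ℝ] W} {w : R' → W} (hQ : ∀ v, Q v = ∑ q, φ q v • w q) (hw : ∀ q, ‖w q‖ ≤ 1) :
    ‖Q ∘L rangeIncl S ∘L orthProj hS.orthSystem_rangeHaar‖ ≤
      4 ^ n * (Fintype.card R' * δ) := by
  rw [← ContinuousLinearMap.comp_assoc]
  refine (norm_comp_orthProj_le_of_eq_sum_smul hS.orthSystem_rangeHaar
    (φ := fun q v => φ q (rangeIncl S v)) (fun v => hQ _) hw hδ h.abs_functional_le).trans ?_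
  gcongr
  exact card_haarIndex_mul_le n

theorem exists_isOrthProj [Fintype R] [Fintype R'] (h : AlmostDiagonal T f φ S θ r δ)
    (hS : IsCompression θ S) (hδ : 0 ≤ δ) {Z W : Type*} [SeminormedAddCommGroup Z]
    [NormedSpace ℝ Z] [SeminormedAddCommGroup W] [NormedSpace ℝ W] {Q₁ : Z →L[ℝ] LpI p}
    {Q₂ : X →L[ℝ] W} {ψ : R → Z →L[ℝ] ℝ} {w : R' → W} (hQ₁ : ∀ z, Q₁ z = ∑ q, ψ q z • f q)
    (hQ₂ : ∀ v, Q₂ v = ∑ q, φ q v • w q) {D : ℝ} (hD : 0 ≤ D) (hψ : ∀ q, ‖ψ q‖ ≤ D)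
    (hw : ∀ q, ‖w q‖ ≤ 1) (V : Submodule ℝ (LpI p)) :
    ∃ E : LpI p →L[ℝ] rangeLp S, IsOrthProj (rangeLp S) E ∧
      ‖E ∘L T ∘L rangeIncl S - r • ContinuousLinearMap.id ℝ (rangeLp S)‖ ≤
        4 ^ n * (4 ^ n * δ) ∧
      ‖E ∘L Q₁‖ ≤ 4 ^ n * (Fintype.card R * (D * δ)) ∧
      ‖Q₂ ∘L rangeIncl S ∘L E ∘L V.subtypeL‖ ≤ 4 ^ n * (Fintype.card R' * δ) := by
  refine ⟨orthProj hS.orthSystem_rangeHaar, isOrthProj_orthProj _ (span_range_rangeHaar S),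
    h.norm_orthProj_comp_sub_smul_id_le hS hδ, h.norm_orthProj_comp_le hS hδ hQ₁ hD hψ, ?_⟩
  rw [← ContinuousLinearMap.comp_assoc, ← ContinuousLinearMap.comp_assoc]
  refine (norm_comp_subtypeL_le V _).trans ?_
  rw [ContinuousLinearMap.comp_assoc]
  exact h.norm_comp_orthProj_le hS hδ hQ₂ hw

end AlmostDiagonal

end RangeHaar

theorem mainTheorem5 (p : ℝ≥0∞) [Fact (1 ≤ p)] (hp1 : 1 < p) (hp : p ≠ ∞)
    (n m : ℕ) (hn : 1 ≤ n) (hm : 1 ≤ m) (Γ ε : ℝ) (hΓ : 0 < Γ) (hε0 : 0 < ε) (hε1 : ε < 1) :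
    ∃ k₀ : ℕ, ∀ k : ℕ, k₀ ≤ k →
      ∀ (X : Submodule ℝ (LpI p)) (T : X →L[ℝ] LpI p), ‖T‖ ≤ Γ →
      ∀ (Z : Type*) [NormedAddCommGroup Z] [NormedSpace ℝ Z]
        (W : Type*) [NormedAddCommGroup W] [NormedSpace ℝ W]
        (Q₁ : Z →L[ℝ] LpZero p) (Q₂ : X →L[ℝ] W),
        ‖Q₁‖ ≤ Γ → ‖Q₂‖ ≤ Γ →
        LinearMap.rank (Q₁ : Z →ₗ[ℝ] LpZero p) ≤ m → LinearMap.rank (Q₂ : X →ₗ[ℝ] W) ≤ m →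
      ∀ (N : ℕ), 1 ≤ N → ∀ (S : Fin N → (LpHaar p k →ₗ[ℝ] X)) (θ : Fin N → ℝ),
        (∀ l, IsCompression (θ l) (S l)) → DisjointRanges S →
      ∃ J : Fin N → (LpHaar p n →ₗ[ℝ] LpHaar p k),
        (∀ l, IsDistEmbedding (J l)) ∧
        IsCompression (∑ l, θ l) (assembled S J) ∧
        ∃ E : LpI p →L[ℝ] rangeLp (assembled S J),
          IsOrthProj (rangeLp (assembled S J)) E ∧
          (∃ i : Fin k,
            ‖E ∘L T ∘L rangeIncl (assembled S J) -
              diagAverage T S (∑ l, θ l) i •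
                ContinuousLinearMap.id ℝ (rangeLp (assembled S J))‖ < ε) ∧
          ‖E ∘L (LpZero p).subtypeL ∘L Q₁‖ < ε ∧
          ‖Q₂ ∘L rangeIncl (assembled S J) ∘L E ∘L (LpZero p).subtypeL‖ < ε := by
  obtain ⟨δ, hδ, hδε⟩ := exists_pos_mul_lt hε0 (4 ^ n * (4 ^ n + m * (1 + 2 ^ m * Γ)))
  obtain ⟨hδ₁, hδ₂, hδ₃⟩ : 4 ^ n * (4 ^ n * δ) < ε ∧ 4 ^ n * (m * (2 ^ m * Γ * δ)) < ε ∧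
      4 ^ n * (m * δ) < ε := by
    refine ⟨?_, ?_, ?_⟩ <;> refine lt_of_le_of_lt ?_ hδε <;> rw [← sub_nonneg] <;> ring_nf <;>
      positivity
  have hΓm : Γ ≤ 2 ^ m * Γ := le_mul_of_one_le_left hΓ.le (one_le_pow₀ one_le_two)
  have hmul : ∀ {x : ℝ}, x ≤ Γ → 2 ^ m * x ≤ 2 ^ m * Γ := fun hx => by gcongr
  obtain ⟨k₀, hk₀⟩ := exists_almostDiagonal_assembled (R := Fin m) (R' := Fin m) hp1 hp hn
    (1 + 2 ^ m * Γ) hδ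
  refine ⟨k₀, fun k hk X T hT Z _ _ W _ _ Q₁ Q₂ hQ₁ hQ₂ hrank₁ hrank₂ N hN S θ hS hd => ?_⟩
  obtain ⟨ψ, f, hQ₁f, hψ, hf⟩ := exists_eq_sum_smul_of_rank_le hrank₁
  obtain ⟨φ, w, hQ₂w, hφ, hw⟩ := exists_eq_sum_smul_of_rank_le hrank₂
  have hθ : 0 < ∑ l, θ l := Finset.sum_pos (fun l _ => (hS l).1) ⟨⟨0, hN⟩, Finset.mem_univ _⟩
  obtain ⟨J, hJ, i, hdiag⟩ := hk₀ k hk (T := T) (f := fun q => (f q : LpI p)) (φ := φ)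
    (by linarith) (fun q => (hf q).trans (by linarith [hmul hΓ.le]))
    (fun q => (hφ q).trans (by linarith [hmul hQ₂])) hS hd hθ
  have hcomp := isCompression_assembled hd hS hθ (sum_le_one_of_disjointRanges i.pos hd hS) hJ
  obtain ⟨E, hE, hET, hEQ₁, hQ₂E⟩ := hdiag.exists_isOrthProj hcomp hδ.le
    (Q₁ := (LpZero p).subtypeL ∘L Q₁) (fun z => by simp [hQ₁f]) hQ₂w
    (by positivity : 0 ≤ 2 ^ m * Γ) (fun q => (hψ q).trans (hmul hQ₁)) hw (LpZero p)
  rw [Fintype.card_fin] at hEQ₁ hQ₂E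
  exact ⟨J, hJ, hcomp, E, hE, ⟨i, hET.trans_lt hδ₁⟩, hEQ₁.trans_lt hδ₂, hQ₂E.trans_lt hδ₃⟩
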